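/- Let $\lambda$ and $\kappa$ be regular cardinals with $\kappa$ uncountable and $\kappa^+<\lambda$. For a set $C$ of ordinals let $\operatorname{otp}(C)$ be its order type, $\operatorname{acc}(C)$ the set of limit ordinals $\alpha\in C$ with $\alpha=\sup(C\cap\alpha)$, and $\operatorname{nacc}(C)=C\setminus\operatorname{acc}(C)$; an ordinal is identified with the set of smaller ordinals. Then there are a stationary set $S\subseteq\{\delta<\lambda:\operatorname{cf}(\delta)=\kappa\}$ and a sequence $\langle\mathcal P_\alpha:\alpha<\lambda\rangle$ such that: (i) for every $\alpha<\lambda$, $\mathcal P_\alpha$ is a family of closed subsets of $\alpha$ (closed in the order topology of $\alpha$), and $|\mathcal P_\alpha|<\lambda$; (ii) $\operatorname{otp}(C)\le\kappa$ for every $C\in\bigcup_{\alpha<\lambda}\mathcal P_\alpha$; (iii) there is a club $E$ of $\lambda$ such that (a) $\mathcal P_\alpha=\emptyset$ for every $\alpha\in\lambda\setminus E$; (b) if $\alpha\in E$, then $\operatorname{otp}(C)\le\kappa$ for all $C\in\mathcal P_\alpha$; (c) if $\alpha\in E\setminus(S\cap\operatorname{acc}(E))$, then $\operatorname{otp}(C)<\kappa$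 for all $C\in\mathcal P_\alpha$; (d) if $\alpha\in S\cap\operatorname{acc}(E)$, then there is exactly one $C\in\mathcal P_\alpha$ with $\operatorname{otp}(C)=\kappa$; (e) if $\alpha\in S\cap\operatorname{acc}(E)$, $C\in\mathcal P_\alpha$ and $\operatorname{otp}(C)=\kappa$, then $\alpha=\sup(C)$; (iv) if $\alpha<\lambda$, $C\in\mathcal P_\alpha$ and $\beta\in\operatorname{nacc}(C)$, then $\beta\cap C\in\mathcal P_\beta$; (v) for every club $E'$ of $\lambda$ there are $\delta\in S\cap E'$ and $C\in\mathcal P_\delta$ with $C\subseteq E'$ and $\operatorname{otp}(C)=\kappa$. -/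

import Mathlib

open Set Cardinal Ordinal Topology

universe u

namespace GuessingClubs

/-- The order type of a set of ordinals. (A set of ordinals of universe `u` lives in universe
`u + 1`, so this is compared with lifts of ordinals of universe `u`.) -/
noncomputable def otp (C : Set Ordinal.{u}) : Ordinal.{u + 1} :=
  Ordinal.type (α := C) (· < ·)

/-- The accumulation points `α ∈ C` of `C`, i.e. the limit ordinals `α ∈ C` with
`α = sup (C ∩ α)`. -/
def acc (C : Set Ordinal.{u}) : Set Ordinal.{u} :=
  {α ∈ C | AccPt α (Filter.principal C)}

/-- The non-accumulation points of `C`. -/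
def nacc (C : Set Ordinal.{u}) : Set Ordinal.{u} :=
  C \ acc C

/-- `C` is a subset of the ordinal `o` (identified with the set of smaller ordinals) that is
closed in `o`. -/
def IsClosedIn (C : Set Ordinal.{u}) (o : Ordinal.{u}) : Prop :=
  C ⊆ Iio o ∧ IsClosed (Subtype.val ⁻¹' C : Set (Iio o))

/-- `E` is a closed unbounded subset of the ordinal `o`. -/
def IsClubIn (E : Set Ordinal.{u}) (o : Ordinal.{u}) : Prop :=
  E ⊆ Iio o ∧ IsClub (Subtype.val ⁻¹' E : Set (Iio o))

/-- `S` is a stationary subset of the ordinal `o`. -/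
def IsStationaryIn (S : Set Ordinal.{u}) (o : Ordinal.{u}) : Prop :=
  S ⊆ Iio o ∧ IsStationary (Subtype.val ⁻¹' S : Set (Iio o))

/-- The property `⊕` of a sequence `⟨P α : α < lam⟩` (values of `P` at `α ≥ lam` play no role),
for a cardinal `lam`, an ordinal `d` and a set `S` of ordinals below `lam`. -/
structure IsGuessingSystem (lam : Cardinal.{u}) (d : Ordinal.{u}) (S : Set Ordinal.{u})
    (P : Ordinal.{u} → Set (Set Ordinal.{u})) : Prop where
  closed : ∀ α < lam.ord, ∀ C ∈ P α, IsClosedIn C α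
  card_lt : ∀ α < lam.ord, Cardinal.mk (P α) < Cardinal.lift.{u + 1} lam
  otp_le : ∀ α < lam.ord, ∀ C ∈ P α, otp C ≤ Ordinal.lift.{u + 1} d
  exists_club : ∃ E : Set Ordinal.{u}, IsClubIn E lam.ord ∧
    (∀ α < lam.ord, α ∉ E → P α = ∅) ∧
    (∀ α ∈ E, ∀ C ∈ P α, otp C ≤ Ordinal.lift.{u + 1} d) ∧
    (∀ α ∈ E \ (S ∩ acc E), ∀ C ∈ P α, otp C < Ordinal.lift.{u + 1} d) ∧
    (∀ α ∈ S ∩ acc E, ∃! C, C ∈ P α ∧ otp C = Ordinal.lift.{u + 1} d) ∧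
    (∀ α ∈ S ∩ acc E, ∀ C ∈ P α, otp C = Ordinal.lift.{u + 1} d → IsLUB C α)
  coherent : ∀ α < lam.ord, ∀ C ∈ P α, ∀ β ∈ nacc C, Iio β ∩ C ∈ P β
  guess : ∀ E' : Set Ordinal.{u}, IsClubIn E' lam.ord →
    ∃ δ ∈ S ∩ E', ∃ C ∈ P δ, C ⊆ E' ∧ otp C = Ordinal.lift.{u + 1} d

end GuessingClubs

/-!
A ladder on `δ` is a closed cofinal subset of `δ` of order type `κ = cf δ`. It suffices to attach to
each `β < λ` a family `Q β` of fewer than `λ` sets such that stationarily many `δ` carry a ladder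
whose initial segment at each of its non-accumulation points `β` belongs to `Q β`.

Indeed, let `E` be a club and push each such ladder down to `E`, replacing each of its elements by
the supremum of `E` below it. An initial segment of the new ladder at a non-accumulation point
`β ∈ E` comes from one of the old ladder at a point that is at most the next element of `E` after
`β`, so fewer than `λ` sets occur at `β`. For some `E` the new ladders guess clubs: otherwise
replace `E` by a counterexample `κ⁺` times, taking intersections at limits. On a given ladder the
`κ` many suprema only decrease, so they stabilize, and the stabilized ladder lies in the next
counterexample.

The families `Q β` come from two different arguments.

* If `λ = μ⁺` with `μ = κ⁺`, fix injections of all `β < λ` into `μ`; they filter `β` by `μ` levels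
  of size less than `μ`. For `δ` of cofinality `κ < μ`, some cofinal level of `δ` induces on each of
  its elements `b` the level of `b` with the same index. Enumerate the closure of the level of `δ`
  and take the image of a fixed ladder on an ordinal below `μ`: its initial segments depend only on
  some `b` below and on ordinals below `μ`.
* If `θ = κ⁺⁺ < λ`, the argument above gives ladders on points of `θ` that guess clubs of `θ`. Let
  `ξ` enumerate a sufficiently sparse part of a given club of `λ`. A normal sequence `f` of length
  `θ` fixed in advance for `δ = ξ θ` agrees with `ξ` on a club of `θ`, hence on a ladder on some
  `j < θ`. Since `f` was fixed in advance, the initial segments of the image of this ladder under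
  `ξ` range over fewer than `λ` sets, and the sparseness of `ξ` makes them appear in time.
-/

namespace GuessingClubs

open Order
open scoped Filter

section AccumulationPoints

variable {A C E S : Set Ordinal.{u}} {x o : Ordinal.{u}}

theorem accPt_principal_iff : AccPt x (𝓟 A) ↔ x ≠ 0 ∧ ∀ y < x, ∃ a ∈ A, y < a ∧ a < x := by
  rw [SuccOrder.accPt_principal]
  simp [Set.Nonempty]

theorem not_accPt_principal_iff (hx : x ≠ 0) :
    ¬ AccPt x (𝓟 A) ↔ ∃ y < x, ∀ a ∈ A, a < x → a ≤ y := by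
  rw [accPt_principal_iff]
  grind

theorem mem_nacc_iff : x ∈ nacc A ↔ x ∈ A ∧ ¬ AccPt x (𝓟 A) := by
  simp only [nacc, acc, mem_sdiff, mem_ofPred_eq]
  tauto

theorem isClosedIn_iff : IsClosedIn C o ↔ C ⊆ Iio o ∧ ∀ x < o, AccPt x (𝓟 C) → x ∈ C := by
  simp [IsClosedIn, isClosed_iff_accPt, ← Filter.comap_principal,
    isOpen_Iio.isOpenEmbedding_subtypeVal.accPt_comap_iff]

theorem IsClosedIn.mem_of_accPt (hC : IsClosedIn C o) (hx : x < o) (h : AccPt x (𝓟 C)) : x ∈ C :=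
  (isClosedIn_iff.1 hC).2 x hx h

theorem isLUB_inter_Iio_of_accPt (h : AccPt x (𝓟 A)) : IsLUB (A ∩ Iio x) x := by
  refine ⟨fun b hb ↦ hb.2.le, fun b hb ↦ not_lt.1 fun hbx ↦ ?_⟩
  obtain ⟨a, ha, hba, hax⟩ := (accPt_principal_iff.1 h).2 b hbx
  exact (hb ⟨ha, hax⟩).not_gt hba

theorem dirSupClosed_preimage_val_iff :
    DirSupClosed (Subtype.val ⁻¹' C : Set (Iio o)) ↔
      IsClosed (Subtype.val ⁻¹' C : Set (Iio o)) := by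
  rw [dirSupClosed_iff_of_linearOrder]
  refine ⟨fun h ↦ isClosed_iff_accPt.2 fun x hx ↦ ?_,
    fun h t ht ht₀ x hx ↦ h.closure_subset_iff.2 ht (hx.mem_closure ht₀)⟩
  rw [← Filter.comap_principal, isOpen_Iio.isOpenEmbedding_subtypeVal.accPt_comap_iff] at hx
  obtain ⟨a, ha, -, hax⟩ := (accPt_principal_iff.1 hx).2 0
    (pos_iff_ne_zero.2 (accPt_principal_iff.1 hx).1)
  refine h (d := Subtype.val ⁻¹' (C ∩ Iio x.1)) (fun y hy ↦ hy.1) ⟨⟨a, hax.trans x.2⟩, ha, hax⟩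
    ⟨fun y hy ↦ hy.2.le, fun b hb ↦ ?_⟩
  exact (isLUB_inter_Iio_of_accPt hx).2 fun y hy ↦ hb (a := ⟨y, (mem_Iio.1 hy.2).trans x.2⟩) hy

theorem isClubIn_iff (ho : IsSuccLimit o) :
    IsClubIn E o ↔ IsClosedIn E o ∧ ∀ x < o, ∃ y ∈ E, x < y := by
  rw [IsClubIn, isClub_iff, dirSupClosed_preimage_val_iff, IsClosedIn, and_assoc]
  refine and_congr_right fun hE ↦ and_congr_right fun _ ↦ ⟨fun h x hx ↦ ?_, fun h x ↦ ?_⟩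
  · obtain ⟨y, hy, hxy⟩ := h ⟨x + 1, ho.add_one_lt hx⟩
    exact ⟨y, hy, (lt_add_one x).trans_le hxy⟩
  · obtain ⟨y, hy, hxy⟩ := h x.1 x.2
    exact ⟨⟨y, hE hy⟩, hy, hxy.le⟩

theorem isStationaryIn_iff :
    IsStationaryIn S o ↔ S ⊆ Iio o ∧ ∀ E, IsClubIn E o → (S ∩ E).Nonempty := by
  refine and_congr_right fun _ ↦ ⟨fun h E hE ↦ ?_, fun h t ht ↦ ?_⟩
  · obtain ⟨x, hx⟩ := h hE.2
    exact ⟨x, hx⟩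
  · have ht' : IsClubIn (Subtype.val '' t) o :=
      ⟨Subtype.coe_image_subset _ t, by rwa [preimage_image_eq _ Subtype.val_injective]⟩
    obtain ⟨_, hx, x, hxt, rfl⟩ := h _ ht'
    exact ⟨x, hx, hxt⟩

end AccumulationPoints

section Clubs

variable {E : Set Ordinal.{u}} {o x : Ordinal.{u}}

theorem isSuccLimit_of_aleph0_lt_cof (ho : ℵ₀ < o.cof) : IsSuccLimit o :=
  one_lt_cof_iff.1 (one_lt_aleph0.trans ho)

theorem isClubIn_Iio_inter_iInter {ι : Type (u + 1)} {f : ι → Set Ordinal.{u}}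
    (ho : o.cof ≠ ℵ₀) (hι : #ι < Cardinal.lift.{u + 1} o.cof) (hf : ∀ i, IsClubIn (f i) o) :
    IsClubIn (Iio o ∩ ⋂ i, f i) o := by
  have hcof : Order.cof (Iio o) = Cardinal.lift.{u + 1} o.cof :=
    (Ordinal.cof_Iio o).trans (lift_cof o).symm
  refine ⟨inter_subset_left, ?_⟩
  simpa [preimage_iInter] using IsClub.iInter (α := Iio o) (f := fun i ↦ Subtype.val ⁻¹' f i)
    (by rwa [hcof, ne_eq, lift_eq_aleph0]) (by rw [hcof]; simpa using hι) fun i ↦ (hf i).2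

theorem exists_lt_forall_lt_apply_lt (ho : ℵ₀ < o.cof) {F : Ordinal.{u} → Ordinal.{u}}
    (hF : ∀ y < o, y < F y ∧ F y < o) (hx : x < o) :
    ∃ y < o, x < y ∧ ∀ z < y, ∃ v, z < v ∧ v < F v ∧ F v < y := by
  have hlt : nfp F x < o := nfp_lt_ord ho (fun y hy ↦ (hF y hy).2) hx
  have hiter : ∀ n, F^[n] x < F^[n + 1] x ∧ F^[n + 1] x < nfp F x := by
    have h : ∀ n, F^[n] x < F^[n + 1] x := fun n ↦ by
      rw [Function.iterate_succ_apply']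
      exact (hF _ ((iterate_le_nfp F x n).trans_lt hlt)).1
    exact fun n ↦ ⟨h n, (h (n + 1)).trans_le (iterate_le_nfp F x (n + 2))⟩
  refine ⟨nfp F x, hlt, (hiter 0).1.trans (hiter 0).2, fun z hz ↦ ?_⟩
  obtain ⟨n, hn⟩ := lt_nfp_iff.1 hz
  refine ⟨F^[n] x, hn, ?_⟩
  rw [← Function.iterate_succ_apply' F]
  exact hiter n

theorem IsClubIn.acc (hE : IsClubIn E o) (ho : ℵ₀ < o.cof) : IsClubIn (acc E) o := by
  have hlim := isSuccLimit_of_aleph0_lt_cof ho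
  obtain ⟨hcl, hunb⟩ := (isClubIn_iff hlim).1 hE
  refine (isClubIn_iff hlim).2 ⟨isClosedIn_iff.2 ⟨fun x hx ↦ hE.1 hx.1, fun x hx h ↦ ?_⟩,
    fun x hx ↦ ?_⟩
  · have hx' : AccPt x (𝓟 E) := h.mono (Filter.principal_mono.2 fun y hy ↦ hy.1)
    exact ⟨hcl.mem_of_accPt hx hx', hx'⟩
  · choose! F hFE hF using hunb
    obtain ⟨y, hy, hxy, h⟩ := exists_lt_forall_lt_apply_lt ho
      (fun y hy ↦ ⟨hF y hy, hE.1 (hFE y hy)⟩) hx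
    have hacc : AccPt y (𝓟 E) := accPt_principal_iff.2 ⟨(bot_lt_of_lt hxy).ne', fun z hz ↦ by
      obtain ⟨v, hzv, hvF, hFy⟩ := h z hz
      exact ⟨F v, hFE v (hvF.trans (hFy.trans hy)), hzv.trans hvF, hFy⟩⟩
    exact ⟨y, ⟨hcl.mem_of_accPt hy hacc, hacc⟩, hxy⟩

theorem exists_lt_forall_mem_lt {X : Set Ordinal.{u}}
    (hX : #X < Cardinal.lift.{u + 1} o.cof) (h : ∀ x ∈ X, x < o) : ∃ β < o, ∀ x ∈ X, x < β := by
  refine ⟨_, sSup_add_one_lt_of_lt_cof (by rwa [← lift_cof]) h, fun x hx ↦ ?_⟩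
  have hb : BddAbove ((· + 1) '' X) := ⟨o, forall_mem_image.2 fun y hy ↦ add_one_le_of_lt (h y hy)⟩
  exact (lt_add_one x).trans_le (le_csSup hb ⟨x, hx, rfl⟩)

end Clubs

section OrderType

variable {A : Set Ordinal.{u}} {c : Cardinal.{u + 1}}

theorem otp_lt_ord_iff : otp A < c.ord ↔ #A < c := by
  rw [Cardinal.lt_ord, otp, card_type]

theorem otp_le_ord (h : ∀ x ∈ A, #(A ∩ Iio x : Set Ordinal.{u}) < c) : otp A ≤ c.ord := by
  refine le_of_forall_lt fun b hb ↦ ?_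
  obtain ⟨⟨x, hx⟩, rfl⟩ := typein_surj _ hb
  rw [Cardinal.lt_ord, card_typein]
  refine (mk_le_of_injective (β := (A ∩ Iio x : Set Ordinal.{u}))
    (f := fun y ↦ ⟨y.1.1, y.1.2, y.2⟩) fun y z hyz ↦ ?_).trans_lt (h x hx)
  have hval : y.1.1 = z.1.1 := by simpa using Subtype.ext_iff.1 hyz
  exact Subtype.ext (Subtype.ext hval)

end OrderType

/-- A ladder of length `κ` on `δ`: a closed cofinal set of positive elements of `δ` whose order
type is the cardinal `κ = cf δ`, which is expressed by the size of its proper initial segments (see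
`IsLadder.otp_eq`). Leaving out `0` makes every `m ∈ nacc A` exceed some bound `k < m` of the
smaller elements of `A`. -/
structure IsLadder (κ : Cardinal.{u}) (δ : Ordinal.{u}) (A : Set Ordinal.{u}) : Prop where
  cof_eq : δ.cof = κ
  isClosedIn : IsClosedIn A δ
  exists_gt : ∀ x < δ, ∃ a ∈ A, x < a
  pos : ∀ a ∈ A, 0 < a
  mk_lt : ∀ x < δ, #(A ∩ Iio x : Set Ordinal.{u}) < Cardinal.lift.{u + 1} κ

namespace IsLadder

variable {κ : Cardinal.{u}} {δ : Ordinal.{u}} {A : Set Ordinal.{u}}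

theorem subset_Iio (h : IsLadder κ δ A) : A ⊆ Iio δ :=
  h.isClosedIn.1

theorem isSuccLimit (h : IsLadder κ δ A) (hκ : ℵ₀ ≤ κ) : IsSuccLimit δ := by
  rw [← one_lt_cof_iff, h.cof_eq]
  exact one_lt_aleph0.trans_le hκ

theorem isLUB (h : IsLadder κ δ A) : IsLUB A δ := by
  refine ⟨fun x hx ↦ (h.subset_Iio hx).le, fun b hb ↦ not_lt.1 fun hlt ↦ ?_⟩
  obtain ⟨a, ha, hba⟩ := h.exists_gt b hlt
  exact (hb ha).not_gt hba

theorem accPt (h : IsLadder κ δ A) (hδ : δ ≠ 0) : AccPt δ (𝓟 A) :=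
  accPt_principal_iff.2 ⟨hδ, fun x hx ↦ by
    obtain ⟨a, ha, hxa⟩ := h.exists_gt x hx
    exact ⟨a, ha, hxa, h.subset_Iio ha⟩⟩

theorem lift_le_mk (h : IsLadder κ δ A) : Cardinal.lift.{u + 1} κ ≤ #A := by
  by_contra! hlt
  rw [← h.cof_eq] at hlt
  obtain ⟨x, hx, hAx⟩ := exists_lt_forall_mem_lt hlt h.subset_Iio
  obtain ⟨a, ha, hxa⟩ := h.exists_gt x hx
  exact (hAx a ha).not_gt hxa

theorem otp_eq (h : IsLadder κ δ A) : otp A = Ordinal.lift.{u + 1} κ.ord := by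
  rw [Cardinal.lift_ord]
  exact (otp_le_ord fun x hx ↦ h.mk_lt x (h.subset_Iio hx)).antisymm
    (not_lt.1 fun hlt ↦ h.lift_le_mk.not_gt (otp_lt_ord_iff.1 hlt))

theorem mk_eq (h : IsLadder κ δ A) : #A = Cardinal.lift.{u + 1} κ := by
  rw [← Cardinal.card_ord (Cardinal.lift κ), ← Cardinal.lift_ord, ← h.otp_eq, otp, card_type]

theorem otp_Iio_inter_lt (h : IsLadder κ δ A) {β : Ordinal.{u}} (hβ : β < δ) :
    otp (Iio β ∩ A) < Ordinal.lift.{u + 1} κ.ord := by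
  rw [Cardinal.lift_ord, otp_lt_ord_iff, inter_comm]
  exact h.mk_lt β hβ

end IsLadder

theorem mk_Iio_lt_lift_of_lt_ord {κ : Cardinal.{u}} {x : Ordinal.{u}} (hx : x < κ.ord) :
    #(Iio x) < Cardinal.lift.{u + 1} κ := by
  rw [Cardinal.mk_Iio_ordinal, Cardinal.lift_lt]
  exact Cardinal.lt_ord.1 hx

theorem isLadder_Ioo {κ : Cardinal.{u}} (hκ : κ.IsRegular) :
    IsLadder κ κ.ord (Ioo 0 κ.ord) where
  cof_eq := hκ.cof_ord
  isClosedIn := isClosedIn_iff.2 ⟨fun _ hx ↦ hx.2, fun _ hx h ↦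
    ⟨pos_iff_ne_zero.2 (accPt_principal_iff.1 h).1, hx⟩⟩
  exists_gt x hx := ⟨x + 1, ⟨bot_lt_of_lt (lt_add_one x),
    (isSuccLimit_ord hκ.aleph0_le).add_one_lt hx⟩, lt_add_one x⟩
  pos _ ha := ha.1
  mk_lt _ hx := (mk_le_mk_of_subset inter_subset_right).trans_lt (mk_Iio_lt_lift_of_lt_ord hx)

section NormalImages

variable {f g : Ordinal.{u} → Ordinal.{u}} {C : Set Ordinal.{u}} {x β δ : Ordinal.{u}}

theorem accPt_image_iff_of_isNormal (hf : IsNormal f) :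
    AccPt x (𝓟 (f '' C)) ↔ ∃ i, f i = x ∧ AccPt i (𝓟 C) := by
  constructor
  · intro h
    have himage : f '' C ∩ Iio x = f '' (C ∩ f ⁻¹' Iio x) := image_inter_preimage f C _ |>.symm
    have hx := isLUB_inter_Iio_of_accPt h
    rw [accPt_principal_iff] at h
    obtain ⟨_, ⟨a, ha, rfl⟩, -, hax⟩ := h.2 0 (pos_iff_ne_zero.2 h.1)
    have hbdd : BddAbove (C ∩ f ⁻¹' Iio x) :=
      ⟨x, fun k hk ↦ hf.strictMono.le_apply.trans (mem_Iio.1 hk.2).le⟩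
    have hne : (C ∩ f ⁻¹' Iio x).Nonempty := ⟨a, ha, hax⟩
    obtain ⟨i, hi⟩ : ∃ i, IsLUB (C ∩ f ⁻¹' Iio x) i := ⟨_, isLUB_csSup hne hbdd⟩
    obtain rfl : f i = x := (hf.map_isLUB hi hne).unique (himage ▸ hx)
    refine ⟨i, rfl, accPt_principal_iff.2 ⟨(bot_lt_of_lt (hf.strictMono.lt_iff_lt.1 hax)).ne',
      fun y hy ↦ ?_⟩⟩
    obtain ⟨_, ⟨b, hb, rfl⟩, hyb, hbi⟩ := h.2 _ (hf.strictMono hy)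
    exact ⟨b, hb, hf.strictMono.lt_iff_lt.1 hyb, hf.strictMono.lt_iff_lt.1 hbi⟩
  · rintro ⟨i, rfl, hi⟩
    have hlim := hi.isSuccLimit
    rw [accPt_principal_iff] at hi ⊢
    refine ⟨(bot_lt_of_lt (hf.strictMono (pos_iff_ne_zero.2 hi.1))).ne', fun y hy ↦ ?_⟩
    obtain ⟨k, hk, hyk⟩ := (hf.lt_iff_exists_lt hlim).1 hy
    obtain ⟨a, ha, hka, hai⟩ := hi.2 k hk
    exact ⟨f a, mem_image_of_mem f ha, hyk.trans (hf.strictMono hka), hf.strictMono hai⟩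

theorem exists_Iio_inter_image_eq_of_mem_nacc (hf : IsNormal f) (hC : ∀ m ∈ C, 0 < m)
    (hβ : β ∈ nacc (f '' C)) :
    ∃ m ∈ C, ∃ k < m, f m = β ∧ Iio β ∩ f '' C = f '' (C ∩ Iic k) := by
  obtain ⟨⟨m, hm, rfl⟩, hacc⟩ := mem_nacc_iff.1 hβ
  obtain ⟨k, hkm, hk⟩ := (not_accPt_principal_iff (hC m hm).ne').1 fun h ↦
    hacc ((accPt_image_iff_of_isNormal hf).2 ⟨m, rfl, h⟩)
  refine ⟨m, hm, k, hkm, rfl, ?_⟩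
  ext x
  constructor
  · rintro ⟨hx, a, ha, rfl⟩
    exact ⟨a, ⟨ha, hk a ha (hf.strictMono.lt_iff_lt.1 hx)⟩, rfl⟩
  · rintro ⟨a, ⟨ha, hak⟩, rfl⟩
    exact ⟨hf.strictMono (lt_of_le_of_lt hak hkm), a, ha, rfl⟩

theorem IsLadder.image {κ : Cardinal.{u}} (hC : IsLadder κ δ C) (hκ : ℵ₀ ≤ κ)
    (hf : IsNormal f) : IsLadder κ (f δ) (f '' C) := by
  have hδ := hC.isSuccLimit hκ
  refine ⟨(cof_map_of_isNormal hf hδ).trans hC.cof_eq, isClosedIn_iff.2 ⟨?_, fun x hx h ↦ ?_⟩,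
    fun x hx ↦ ?_, ?_, fun x hx ↦ ?_⟩
  · exact image_subset_iff.2 fun a ha ↦ hf.strictMono (hC.subset_Iio ha)
  · obtain ⟨i, rfl, hi⟩ := (accPt_image_iff_of_isNormal hf).1 h
    exact mem_image_of_mem f (hC.isClosedIn.mem_of_accPt (hf.strictMono.lt_iff_lt.1 hx) hi)
  · obtain ⟨k, hk, hxk⟩ := (hf.lt_iff_exists_lt hδ).1 hx
    obtain ⟨a, ha, hka⟩ := hC.exists_gt k hk
    exact ⟨f a, mem_image_of_mem f ha, hxk.trans (hf.strictMono hka)⟩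
  · exact forall_mem_image.2 fun a ha ↦ bot_lt_of_lt (hf.strictMono (hC.pos a ha))
  · obtain ⟨k, hk, hxk⟩ := (hf.lt_iff_exists_lt hδ).1 hx
    refine (mk_le_mk_of_subset ?_).trans_lt ((mk_image_le (f := f)).trans_lt (hC.mk_lt k hk))
    rintro _ ⟨⟨a, ha, rfl⟩, hax⟩
    exact ⟨a, ⟨ha, hf.strictMono.lt_iff_lt.1 ((mem_Iio.1 hax).trans hxk)⟩, rfl⟩

theorem isClubIn_setOf_eq_of_isNormal (hf : IsNormal f) (hg : IsNormal g) (hδ : ℵ₀ < δ.cof)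
    (hfg : f δ = g δ) : IsClubIn {x | x < δ ∧ f x = g x} δ := by
  have hlim := isSuccLimit_of_aleph0_lt_cof hδ
  refine (isClubIn_iff hlim).2 ⟨isClosedIn_iff.2 ⟨fun x hx ↦ hx.1, fun x hx h ↦ ⟨hx, ?_⟩⟩,
    fun x hx ↦ ?_⟩
  · have hclosed : IsClosed {x | f x = g x} := isClosed_eq hf.continuous hg.continuous
    exact isClosed_iff_accPt.1 hclosed x (h.mono (Filter.principal_mono.2 fun y hy ↦ hy.2))
  · have hstep : ∀ x < δ, ∃ y, (x < y ∧ y < δ) ∧ f x < g y ∧ g x < f y := fun x hx ↦ by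
      obtain ⟨y, hy, hxy⟩ := (hg.lt_iff_exists_lt hlim).1 (hfg ▸ hf.strictMono hx)
      obtain ⟨z, hz, hxz⟩ := (hf.lt_iff_exists_lt hlim).1 (hfg ▸ hg.strictMono hx)
      have hxm : x < x + 1 := lt_add_one x
      refine ⟨max (x + 1) (max y z), ⟨lt_max_of_lt_left hxm,
        max_lt (hlim.add_one_lt hx) (max_lt hy hz)⟩, hxy.trans_le (hg.monotone (by simp)),
        hxz.trans_le (hf.monotone (by simp))⟩
    choose! F hF hfF hgF using hstep
    obtain ⟨y, hy, hxy, h⟩ := exists_lt_forall_lt_apply_lt hδ hF hx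
    have hylim : IsSuccLimit y := isSuccLimit_iff.2 ⟨(bot_lt_of_lt hxy).ne', fun z hz ↦ by
      obtain ⟨v, hzv, hvF, hFy⟩ := h z hz.lt
      exact hz.2 hzv (hvF.trans hFy)⟩
    refine ⟨y, ⟨hy, le_antisymm ((hf.le_iff_forall_le hylim).2 fun z hz ↦ ?_)
      ((hg.le_iff_forall_le hylim).2 fun z hz ↦ ?_)⟩, hxy⟩
    · obtain ⟨v, hzv, hvF, hFy⟩ := h z hz
      exact ((hf.strictMono hzv).trans ((hfF v (hvF.trans (hFy.trans hy))).trans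
        (hg.strictMono hFy))).le
    · obtain ⟨v, hzv, hvF, hFy⟩ := h z hz
      exact ((hg.strictMono hzv).trans ((hgF v (hvF.trans (hFy.trans hy))).trans
        (hf.strictMono hFy))).le

end NormalImages

section ClosureEnumeration

variable {X Y : Set Ordinal.{u}} {b i δ : Ordinal.{u}}

theorem not_bddAbove_closure (hX : ¬ BddAbove X) : ¬ BddAbove (closure X) :=
  fun h ↦ hX (h.mono subset_closure)

theorem isNormal_enumOrd_closure (hX : ¬ BddAbove X) : IsNormal (enumOrd (closure X)) :=
  isNormal_enumOrd (fun _ ht hne hbdd ↦ isClosed_closure.closure_subset_iff.2 ht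
    (csSup_mem_closure hne hbdd)) (not_bddAbove_closure hX)

theorem enumOrd_closure_add_one_mem (hX : ¬ BddAbove X) (i : Ordinal.{u}) :
    enumOrd (closure X) (i + 1) ∈ X := by
  have hX' := not_bddAbove_closure hX
  refine ((closure_eq_self_union_derivedSet X).subset
    (enumOrd_mem hX' (i + 1))).resolve_right fun hacc ↦ ?_
  obtain ⟨a, ha, hia, hai⟩ := (accPt_principal_iff.1 hacc).2 _
    (enumOrd_strictMono hX' (lt_add_one i))
  exact hai.not_ge (enumOrd_succ_le hX' (subset_closure ha) hia)

theorem lift_card_le_mk_inter_Iic_enumOrd_closure (hX : ¬ BddAbove X) (i : Ordinal.{u}) :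
    Cardinal.lift.{u + 1} i.card ≤ #(X ∩ Iic (enumOrd (closure X) i) : Set Ordinal.{u}) := by
  have hmono := enumOrd_strictMono (not_bddAbove_closure hX)
  rw [← Cardinal.mk_Iio_ordinal]
  refine mk_le_of_injective (f := fun j : Iio i ↦ ⟨enumOrd (closure X) (j + 1),
    enumOrd_closure_add_one_mem hX j, hmono.monotone (add_one_le_of_lt j.2)⟩) fun j k h ↦ ?_
  exact Subtype.ext (succ_injective (hmono.injective (Subtype.ext_iff.1 h)))

theorem exists_isSuccLimit_enumOrd_closure_eq (hX : ¬ BddAbove X) (hδ : AccPt δ (𝓟 X))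
    (hδX : δ ∉ X) : ∃ ε, IsSuccLimit ε ∧ enumOrd (closure X) ε = δ := by
  have hX' := not_bddAbove_closure hX
  obtain ⟨ε, rfl⟩ := enumOrd_surjective hX'
    ((closure_eq_self_union_derivedSet X).superset (Or.inr hδ))
  refine ⟨ε, ?_, rfl⟩
  rcases zero_or_succ_or_isSuccLimit ε with rfl | ⟨j, rfl⟩ | hε
  · obtain ⟨a, ha, -, haδ⟩ := (accPt_principal_iff.1 hδ).2 0
      (pos_iff_ne_zero.2 (accPt_principal_iff.1 hδ).1)
    exact absurd (enumOrd_le_of_forall_lt (subset_closure ha) (by simp)) haδ.not_ge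
  · exact absurd (enumOrd_closure_add_one_mem hX j) hδX
  · exact hε

theorem enumOrd_eq_of_inter_Iic_eq (hX : ¬ BddAbove X) (hY : ¬ BddAbove Y)
    (h : X ∩ Iic b = Y ∩ Iic b) (hi : enumOrd X i ≤ b) : enumOrd Y i = enumOrd X i := by
  induction i using WellFoundedLT.induction with
  | ind i ih =>
    have hlt : ∀ j < i, enumOrd X j < enumOrd X i := fun j hj ↦ enumOrd_strictMono hX hj
    have hmem : enumOrd X i ∈ Y := (h.subset ⟨enumOrd_mem hX i, hi⟩).1
    have hle : enumOrd Y i ≤ enumOrd X i := enumOrd_le_of_forall_lt hmem fun j hj ↦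
      (ih j hj ((hlt j hj).le.trans hi)).trans_lt (hlt j hj)
    refine hle.antisymm (enumOrd_le_of_forall_lt
      (h.superset ⟨enumOrd_mem hY i, hle.trans hi⟩).1 fun j hj ↦ ?_)
    exact (ih j hj ((hlt j hj).le.trans hi)).symm.trans_lt (enumOrd_strictMono hY hj)

theorem closure_inter_Iic (X : Set Ordinal.{u}) (b : Ordinal.{u}) :
    closure X ∩ Iic b = closure (X ∩ Iic b) := by
  have hopen : IsOpen (Iic b) := by
    rw [← Order.Iio_succ]
    exact isOpen_Iio
  refine Subset.antisymm ?_ ((closure_inter_subset_inter_closure _ _).trans_eq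
    (by rw [isClosed_Iic.closure_eq]))
  simpa only [inter_comm] using hopen.inter_closure (t := X)

theorem image_enumOrd_closure_inter_Iic_congr (hX : ¬ BddAbove X) (hY : ¬ BddAbove Y)
    (h : X ∩ Iic b = Y ∩ Iic b) (c : Set Ordinal.{u}) :
    enumOrd (closure X) '' c ∩ Iic b = enumOrd (closure Y) '' c ∩ Iic b := by
  have hcl : closure X ∩ Iic b = closure Y ∩ Iic b := by
    rw [closure_inter_Iic, closure_inter_Iic, h]
  have hX' := not_bddAbove_closure hX
  have hY' := not_bddAbove_closure hY
  apply Subset.antisymm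
  · rintro _ ⟨⟨i, hi, rfl⟩, hib⟩
    exact ⟨⟨i, hi, enumOrd_eq_of_inter_Iic_eq hX' hY' hcl hib⟩, hib⟩
  · rintro _ ⟨⟨i, hi, rfl⟩, hib⟩
    exact ⟨⟨i, hi, enumOrd_eq_of_inter_Iic_eq hY' hX' hcl.symm hib⟩, hib⟩

theorem exists_cofinal_mk_inter_Iic_lt (hδ : IsSuccLimit δ) :
    ∃ X ⊆ Iio δ, (∀ y < δ, ∃ z ∈ X, y < z) ∧
      ∀ y < δ, #(X ∩ Iic y : Set Ordinal.{u}) < Cardinal.lift.{u + 1} δ.cof := by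
  obtain ⟨s, hs, hstype⟩ := exists_ord_cof_eq (Iio δ)
  rw [Ordinal.cof_Iio, ← lift_cof] at hstype
  have hcofinal : ∀ y < δ, ∃ z ∈ s, y < z.1 := fun y hy ↦ by
    obtain ⟨z, hz, hyz⟩ := hs ⟨y + 1, hδ.add_one_lt hy⟩
    exact ⟨z, hz, (lt_add_one y).trans_le hyz⟩
  refine ⟨Subtype.val '' s, Subtype.coe_image_subset _ s, fun y hy ↦ ?_, fun y hy ↦ ?_⟩
  · obtain ⟨z, hz, hyz⟩ := hcofinal y hy
    exact ⟨z, mem_image_of_mem _ hz, hyz⟩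
  · obtain ⟨z, hz, hyz⟩ := hcofinal y hy
    have hlt := typein_lt_type (α := s) (· < ·) ⟨z, hz⟩
    rw [hstype, Cardinal.lt_ord, card_typein] at hlt
    have hsub : Subtype.val '' s ∩ Iic y ⊆
        range fun w : {w : s // w < ⟨z, hz⟩} ↦ (w.1.1.1 : Ordinal.{u}) := by
      rintro _ ⟨⟨w, hw, rfl⟩, hwy⟩
      have hwz : w.1 < z.1 := lt_of_le_of_lt hwy hyz
      exact ⟨⟨⟨w, hw⟩, hwz⟩, rfl⟩
    exact (mk_le_mk_of_subset hsub).trans_lt (mk_range_le.trans_lt hlt)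

theorem exists_isNormal_apply_cof_ord (hδ : IsSuccLimit δ) :
    ∃ f : Ordinal.{u} → Ordinal.{u}, IsNormal f ∧ f δ.cof.ord = δ := by
  obtain ⟨s, hsδ, hs, hsmall⟩ := exists_cofinal_mk_inter_Iic_lt hδ
  have hX : ¬ BddAbove (s ∪ Ioi δ) := fun h ↦ not_bddAbove_Ioi δ (h.mono subset_union_right)
  have hacc : AccPt δ (𝓟 (s ∪ Ioi δ)) := accPt_principal_iff.2 ⟨hδ.bot_lt.ne', fun y hy ↦ by
    obtain ⟨z, hz, hyz⟩ := hs y hy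
    exact ⟨z, Or.inl hz, hyz, hsδ hz⟩⟩
  have hδX : δ ∉ s ∪ Ioi δ := by
    rintro (h | h)
    · exact lt_irrefl δ (hsδ h)
    · exact lt_irrefl δ h
  obtain ⟨ε, hε, hεδ⟩ := exists_isSuccLimit_enumOrd_closure_eq hX hacc hδX
  have hf := isNormal_enumOrd_closure hX
  suffices ε = δ.cof.ord from ⟨_, hf, this ▸ hεδ⟩
  refine le_antisymm (le_of_forall_lt fun j hj ↦ ?_) ?_
  · have hjδ := (hf.strictMono hj).trans_eq hεδ
    rw [Cardinal.lt_ord, ← Cardinal.lift_lt.{u, u + 1}]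
    refine (lift_card_le_mk_inter_Iic_enumOrd_closure hX j).trans_lt
      ((mk_le_mk_of_subset ?_).trans_lt (hsmall _ hjδ))
    rintro x ⟨hx | hx, hxj⟩
    · exact ⟨hx, hxj⟩
    · exact absurd (hxj.trans hjδ.le) (mem_Ioi.1 hx).not_ge
  · nth_rw 1 [← hεδ]
    rw [cof_map_of_isNormal hf hε]
    exact ord_cof_le ε

end ClosureEnumeration

theorem exists_isLadder {κ : Cardinal.{u}} {δ : Ordinal.{u}} (hκ : κ.IsRegular) (hδ : δ.cof = κ) :
    ∃ A, IsLadder κ δ A := by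
  have hlim : IsSuccLimit δ := by
    rw [← one_lt_cof_iff, hδ]
    exact one_lt_aleph0.trans_le hκ.aleph0_le
  obtain ⟨f, hf, hfδ⟩ := exists_isNormal_apply_cof_ord hlim
  rw [hδ] at hfδ
  exact ⟨_, hfδ ▸ (isLadder_Ioo hκ).image hκ.aleph0_le hf⟩

/-- The supremum of the elements of `E` below `α`, which is `0` if there are none. -/
noncomputable def below (E : Set Ordinal.{u}) (α : Ordinal.{u}) : Ordinal.{u} :=
  sSup (E ∩ Iio α)

/-- The result of pushing the elements of `A` down to `E ∪ acc E`. The value `0`, which `below E`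
takes when nothing of `E` lies below its argument, is discarded. -/
def drop (E A : Set Ordinal.{u}) : Set Ordinal.{u} :=
  below E '' A \ {0}

section Drop

variable {A E F : Set Ordinal.{u}} {x α β δ o : Ordinal.{u}} {κ : Cardinal.{u}}

theorem le_below (hx : x ∈ E) (h : x < α) : x ≤ below E α :=
  le_csSup ⟨α, fun _ hy ↦ le_of_lt hy.2⟩ ⟨hx, h⟩

theorem below_le : below E α ≤ α :=
  csSup_le' fun _ hy ↦ le_of_lt hy.2

theorem exists_of_lt_below (h : x < below E α) : ∃ e ∈ E, x < e ∧ e < α := by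
  by_contra! hc
  exact h.not_ge (csSup_le' fun e he ↦ not_lt.1 fun hxe ↦ (hc e he.1 hxe).not_gt he.2)

theorem below_mono (h : α ≤ β) : below E α ≤ below E β :=
  csSup_le' fun _ he ↦ le_below he.1 (lt_of_lt_of_le he.2 h)

theorem below_anti (h : F ⊆ E) (α : Ordinal.{u}) : below F α ≤ below E α :=
  csSup_le' fun _ he ↦ le_below (h he.1) he.2

theorem below_eq_self (h : AccPt α (𝓟 E)) : below E α = α :=
  (isLUB_inter_Iio_of_accPt h).csSup_eq <| by
    obtain ⟨hα, h⟩ := accPt_principal_iff.1 h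
    obtain ⟨a, ha, -, haα⟩ := h 0 (pos_iff_ne_zero.2 hα)
    exact ⟨a, ha, haα⟩

theorem IsClosedIn.below_mem (hE : IsClosedIn E o) (hα : α < o) (h0 : below E α ≠ 0) :
    below E α ∈ E := by
  by_contra hn
  refine hn (hE.mem_of_accPt (below_le.trans_lt hα) (accPt_principal_iff.2 ⟨h0, fun y hy ↦ ?_⟩))
  obtain ⟨e, he, hye, heα⟩ := exists_of_lt_below hy
  exact ⟨e, he, hye, (le_below he heα).lt_of_ne fun h ↦ hn (h ▸ he)⟩

theorem IsClosedIn.drop_subset (hE : IsClosedIn E o) (hA : A ⊆ Iio o) : drop E A ⊆ E := by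
  rintro _ ⟨⟨x, hx, rfl⟩, hx0⟩
  exact hE.below_mem (hA hx) hx0

theorem accPt_drop_iff : AccPt x (𝓟 (drop E A)) ↔ AccPt x (𝓟 A) ∧ AccPt x (𝓟 E) := by
  simp only [accPt_principal_iff]
  constructor
  · rintro ⟨hx, h⟩
    have hE : ∀ y < x, ∃ e ∈ E, y < e ∧ e < x := fun y hy ↦ by
      obtain ⟨_, ⟨⟨a, -, rfl⟩, -⟩, hya, hax⟩ := h y hy
      obtain ⟨e, he, hye, hea⟩ := exists_of_lt_below hya
      exact ⟨e, he, hye, (le_below he hea).trans_lt hax⟩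
    refine ⟨⟨hx, fun y hy ↦ ?_⟩, hx, hE⟩
    obtain ⟨_, ⟨⟨a, ha, rfl⟩, -⟩, hya, hax⟩ := h y hy
    refine ⟨a, ha, hya.trans_le below_le, not_le.1 fun hxa ↦ hax.not_ge ?_⟩
    exact (below_eq_self (accPt_principal_iff.2 ⟨hx, hE⟩)).ge.trans (below_mono hxa)
  · rintro ⟨⟨hx, hA⟩, -, hE⟩
    refine ⟨hx, fun y hy ↦ ?_⟩
    obtain ⟨e, he, hye, hex⟩ := hE y hy
    obtain ⟨a, ha, hea, hax⟩ := hA e hex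
    have hya := hye.trans_le (le_below he hea)
    exact ⟨_, ⟨⟨a, ha, rfl⟩, (bot_lt_of_lt hya).ne'⟩, hya, below_le.trans_lt hax⟩

theorem IsLadder.drop (hA : IsLadder κ δ A) (hδ : AccPt δ (𝓟 E)) :
    IsLadder κ δ (drop E A) where
  cof_eq := hA.cof_eq
  isClosedIn := by
    refine isClosedIn_iff.2 ⟨?_, fun x hx h ↦ ?_⟩
    · rintro _ ⟨⟨x, hx, rfl⟩, -⟩
      exact below_le.trans_lt (hA.subset_Iio hx)
    · obtain ⟨hxA, hxE⟩ := accPt_drop_iff.1 h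
      exact ⟨⟨x, hA.isClosedIn.mem_of_accPt hx hxA, below_eq_self hxE⟩,
        (accPt_principal_iff.1 h).1⟩
  exists_gt x hx := by
    have hδA := hA.accPt (accPt_principal_iff.1 hδ).1
    obtain ⟨a, ha, hxa, -⟩ := (accPt_principal_iff.1 (accPt_drop_iff.2 ⟨hδA, hδ⟩)).2 x hx
    exact ⟨a, ha, hxa⟩
  pos _ ha := pos_iff_ne_zero.2 ha.2
  mk_lt β hβ := by
    obtain ⟨e, he, hβe, heδ⟩ := (accPt_principal_iff.1 hδ).2 β hβ
    obtain ⟨a, ha, hea⟩ := hA.exists_gt e heδ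
    have hsub : GuessingClubs.drop E A ∩ Iio β ⊆ below E '' (A ∩ Iio a) := by
      rintro _ ⟨⟨⟨x, hx, rfl⟩, -⟩, hxβ⟩
      refine ⟨x, ⟨hx, mem_Iio.2 (not_le.1 fun hax ↦ ?_)⟩, rfl⟩
      exact (lt_trans hxβ hβe).not_ge (le_below he (hea.trans_le hax))
    exact (mk_le_mk_of_subset hsub).trans_lt
      (mk_image_le.trans_lt (hA.mk_lt a (hA.subset_Iio ha)))

theorem drop_congr (h : ∀ α ∈ A, below E α = below F α) : drop E A = drop F A := by
  rw [drop, drop, image_congr h]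

theorem exists_eq_drop_of_mem_nacc_drop (hβ : β ∈ nacc (drop E A)) :
    ∃ α ∈ nacc A, below E α = β ∧ Iio β ∩ drop E A = drop E (Iio α ∩ A) := by
  obtain ⟨⟨⟨α', hα', hα'β⟩, -⟩, hβacc⟩ := mem_nacc_iff.1 hβ
  obtain ⟨α, ⟨hα, rfl⟩, hmin⟩ := WellFounded.has_min (wellFounded_lt (α := Ordinal.{u}))
    {α | α ∈ A ∧ below E α = β} ⟨α', hα', hα'β⟩
  have hlt : ∀ a ∈ A, a < α → below E a < below E α := fun a ha haα ↦
    (below_mono haα.le).lt_of_ne fun h ↦ hmin a ⟨ha, h⟩ haα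
  refine ⟨α, mem_nacc_iff.2 ⟨hα, fun hαA ↦ hβacc ?_⟩, rfl, ?_⟩
  · have hαE : AccPt α (𝓟 E) := accPt_principal_iff.2 ⟨(accPt_principal_iff.1 hαA).1, fun y hy ↦ by
      obtain ⟨a, ha, hya, haα⟩ := (accPt_principal_iff.1 hαA).2 y hy
      obtain ⟨e, he, hae, heα⟩ := exists_of_lt_below (hlt a ha haα)
      exact ⟨e, he, hya.trans_le (not_lt.1 fun hea ↦ hae.not_ge (le_below he hea)), heα⟩⟩
    rw [below_eq_self hαE]
    exact accPt_drop_iff.2 ⟨hαA, hαE⟩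
  · ext x
    constructor
    · rintro ⟨hx, ⟨a, ha, rfl⟩, hne⟩
      exact ⟨⟨a, ⟨mem_Iio.2 (not_le.1 fun h ↦ (mem_Iio.1 hx).not_ge (below_mono h)), ha⟩, rfl⟩,
        hne⟩
    · rintro ⟨⟨a, ⟨haα, ha⟩, rfl⟩, hne⟩
      exact ⟨hlt a ha haα, ⟨a, ha, rfl⟩, hne⟩

end Drop

/-- The decreasing sequence of subsets of `o` obtained by iterating `F`, intersecting at each
stage over all the previous ones. -/
def iterInter (F : Set Ordinal.{u} → Set Ordinal.{u}) (o ζ : Ordinal.{u}) : Set Ordinal.{u} :=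
  {x | x < o ∧ ∀ ξ, (_ : ξ < ζ) → x ∈ F (iterInter F o ξ)}
termination_by ζ

section ClubGuessing

variable {F : Set Ordinal.{u} → Set Ordinal.{u}} {A : Set Ordinal.{u}} {x o ζ : Ordinal.{u}}

theorem mem_iterInter_iff : x ∈ iterInter F o ζ ↔ x < o ∧ ∀ ξ < ζ, x ∈ F (iterInter F o ξ) := by
  rw [iterInter]
  rfl

theorem antitone_iterInter : Antitone (iterInter F o) := fun ξ ζ h x hx ↦ by
  rw [mem_iterInter_iff] at hx ⊢
  exact ⟨hx.1, fun η hη ↦ hx.2 η (hη.trans_le h)⟩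

theorem iterInter_add_one_subset : iterInter F o (ζ + 1) ⊆ F (iterInter F o ζ) :=
  fun _ hx ↦ (mem_iterInter_iff.1 hx).2 ζ (lt_add_one ζ)

theorem isClubIn_iterInter (hF : ∀ E, IsClubIn E o → IsClubIn (F E) o) (ho : o.cof ≠ ℵ₀)
    (hζ : ζ.card < o.cof) : IsClubIn (iterInter F o ζ) o := by
  induction ζ using WellFoundedLT.induction with
  | ind ζ ih =>
    have heq : iterInter F o ζ = Iio o ∩ ⋂ ξ : Iio ζ, F (iterInter F o ξ) := by
      ext x
      simp [mem_iterInter_iff (ζ := ζ)]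
    rw [heq]
    refine isClubIn_Iio_inter_iInter ho (by rwa [Cardinal.mk_Iio_ordinal, Cardinal.lift_lt])
      fun ξ ↦ hF _ (ih ξ ξ.2 ((Ordinal.card_le_card ξ.2.le).trans_lt hζ))

theorem exists_lt_forall_apply_eq {g : Ordinal.{u} → Ordinal.{u} → Ordinal.{u}}
    (hg : Antitone g) (hA : #A < Cardinal.lift.{u + 1} o.cof) :
    ∃ ζ < o, ∀ ξ < o, ζ ≤ ξ → ∀ α ∈ A, g ξ α = g ζ α := by
  have ho : 0 < o := pos_iff_ne_zero.2 fun h ↦ by simp [h] at hA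
  have hmin : ∀ α, ∃ ζ < o, ∀ ξ < o, g ζ α ≤ g ξ α := fun α ↦ by
    obtain ⟨_, ⟨ζ, hζ, rfl⟩, hm⟩ := WellFounded.has_min (wellFounded_lt (α := Ordinal.{u}))
      ((g · α) '' Iio o) ⟨_, 0, ho, rfl⟩
    exact ⟨ζ, hζ, fun ξ hξ ↦ not_lt.1 (hm _ ⟨ξ, hξ, rfl⟩)⟩
  choose z hz hzmin using hmin
  obtain ⟨ζ, hζ, hzζ⟩ := exists_lt_forall_mem_lt (mk_image_le.trans_lt hA)
    (forall_mem_image.2 fun α _ ↦ hz α)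
  refine ⟨ζ, hζ, fun ξ hξ hζξ α hα ↦ (hg hζξ α).antisymm ?_⟩
  exact (hg (hzζ _ (mem_image_of_mem z hα)).le α).trans (hzmin α ξ hξ)

theorem exists_isClubIn_forall_exists_drop_subset {κ : Cardinal.{u}} (hκ : ℵ₀ ≤ κ)
    (ho : succ κ < o.cof) {S : Set Ordinal.{u}} (hS : IsStationaryIn S o)
    {A : Ordinal.{u} → Set Ordinal.{u}} (hA : ∀ δ ∈ S, IsLadder κ δ (A δ)) :
    ∃ E, IsClubIn E o ∧ ∀ E', IsClubIn E' o → ∃ δ ∈ S ∩ acc E ∩ E', drop E (A δ) ⊆ E' := by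
  have haleph : ℵ₀ < o.cof := (hκ.trans (le_succ κ)).trans_lt ho
  have hlim := isSuccLimit_of_aleph0_lt_cof haleph
  have hreg : (succ κ).IsRegular := isRegular_succ hκ
  by_contra! hcon
  choose! G hGclub hG using hcon
  -- Along the iteration of `G` of length `κ⁺`, the `κ` many ordinals `below E α` with `α ∈ A δ`
  -- become constant, and then the dropped ladder of `δ` lies in the next counterexample.
  have hclub : ∀ ζ ≤ (succ κ).ord, IsClubIn (iterInter G o ζ) o := fun ζ hζ ↦
    isClubIn_iterInter hGclub haleph.ne' <|
      ((Ordinal.card_le_card hζ).trans_eq (card_ord _)).trans_lt ho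
  obtain ⟨δ, hδS, hδ⟩ := (isStationaryIn_iff.1 hS).2 _ ((hclub _ le_rfl).acc haleph)
  have hδo : δ < o := hS.1 hδS
  obtain ⟨ζ, hζ, hstable⟩ := exists_lt_forall_apply_eq (A := A δ) (o := (succ κ).ord)
    (g := fun ζ ↦ below (iterInter G o ζ)) (fun _ _ h ↦ below_anti (antitone_iterInter h))
    (by rw [(hA δ hδS).mk_eq, hreg.cof_ord, Cardinal.lift_lt]; exact lt_succ κ)
  have hζ' := (isSuccLimit_ord hreg.aleph0_le).add_one_lt hζ
  have hmem : ∀ ξ ≤ (succ κ).ord, δ ∈ acc (iterInter G o ξ) := fun ξ hξ ↦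
    ⟨antitone_iterInter hξ hδ.1, hδ.2.mono (Filter.principal_mono.2 (antitone_iterInter hξ))⟩
  refine hG _ (hclub ζ hζ.le) δ
    ⟨⟨hδS, hmem ζ hζ.le⟩, iterInter_add_one_subset (hmem (ζ + 1) hζ'.le).1⟩ ?_
  calc drop (iterInter G o ζ) (A δ)
      = drop (iterInter G o (ζ + 1)) (A δ) :=
        drop_congr fun α hα ↦ (hstable _ hζ' (lt_add_one ζ).le α hα).symm
    _ ⊆ iterInter G o (ζ + 1) := ((isClubIn_iff hlim).1 (hclub _ hζ'.le)).1.drop_subset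
        fun α hα ↦ ((hA δ hδS).subset_Iio hα).trans hδo
    _ ⊆ G (iterInter G o ζ) := iterInter_add_one_subset

end ClubGuessing

/-- The closed sets listed at `β` by the ladders `D δ` with `δ ∈ S`: the initial segments
`D δ ∩ β` for those `δ` with `β ∈ nacc (D δ)`, and the ladder `D β` itself if `β ∈ S`. -/
def initialSegments (S : Set Ordinal.{u}) (D : Ordinal.{u} → Set Ordinal.{u})
    (β : Ordinal.{u}) : Set (Set Ordinal.{u}) :=
  {C | (∃ δ ∈ S, β ∈ nacc (D δ) ∧ C = Iio β ∩ D δ) ∨ (β ∈ S ∧ C = D β)}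

section InitialSegments

variable {κ lam : Cardinal.{u}} {S E : Set Ordinal.{u}} {A D : Ordinal.{u} → Set Ordinal.{u}}
  {Q : Ordinal.{u} → Set (Set Ordinal.{u})} {C : Set Ordinal.{u}} {α β : Ordinal.{u}}

theorem isClosedIn_of_mem_initialSegments (hD : ∀ δ ∈ S, IsLadder κ δ (D δ))
    (hC : C ∈ initialSegments S D β) : IsClosedIn C β := by
  rcases hC with ⟨δ, hδ, hβ, rfl⟩ | ⟨hβ, rfl⟩
  · refine isClosedIn_iff.2 ⟨inter_subset_left, fun x hx h ↦ ⟨hx, ?_⟩⟩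
    exact (hD δ hδ).isClosedIn.mem_of_accPt (hx.trans ((hD δ hδ).subset_Iio hβ.1))
      (h.mono (Filter.principal_mono.2 inter_subset_right))
  · exact (hD β hβ).isClosedIn

theorem otp_lt_or_eq_of_mem_initialSegments (hD : ∀ δ ∈ S, IsLadder κ δ (D δ))
    (hC : C ∈ initialSegments S D β) :
    otp C < Ordinal.lift.{u + 1} κ.ord ∨ (β ∈ S ∧ C = D β) := by
  refine hC.imp_left ?_
  rintro ⟨δ, hδ, hβ, rfl⟩
  exact (hD δ hδ).otp_Iio_inter_lt ((hD δ hδ).subset_Iio hβ.1)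

theorem otp_le_of_mem_initialSegments (hD : ∀ δ ∈ S, IsLadder κ δ (D δ))
    (hC : C ∈ initialSegments S D β) : otp C ≤ Ordinal.lift.{u + 1} κ.ord := by
  rcases otp_lt_or_eq_of_mem_initialSegments hD hC with h | ⟨hβ, rfl⟩
  · exact h.le
  · exact (hD β hβ).otp_eq.le

theorem eq_of_mem_initialSegments_of_otp_eq (hD : ∀ δ ∈ S, IsLadder κ δ (D δ))
    (hC : C ∈ initialSegments S D β) (h : otp C = Ordinal.lift.{u + 1} κ.ord) :
    β ∈ S ∧ C = D β :=
  (otp_lt_or_eq_of_mem_initialSegments hD hC).resolve_left h.not_lt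

theorem Iio_inter_mem_initialSegments (hC : C ∈ initialSegments S D α) (hβ : β ∈ nacc C) :
    Iio β ∩ C ∈ initialSegments S D β := by
  rcases hC with ⟨δ, hδ, -, rfl⟩ | ⟨hα, rfl⟩
  · obtain ⟨⟨hβα, hβD⟩, hβacc⟩ := mem_nacc_iff.1 hβ
    refine Or.inl ⟨δ, hδ, mem_nacc_iff.2 ⟨hβD, fun h ↦ hβacc ?_⟩, ?_⟩
    · rw [accPt_principal_iff] at h ⊢
      refine ⟨h.1, fun y hy ↦ ?_⟩
      obtain ⟨a, ha, hya, haβ⟩ := h.2 y hy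
      exact ⟨a, ⟨haβ.trans hβα, ha⟩, hya, haβ⟩
    · rw [← inter_assoc, Iio_inter_Iio, inf_eq_left.2 (mem_Iio.1 hβα).le]
  · exact Or.inl ⟨α, hα, hβ, rfl⟩

theorem initialSegments_eq_empty (hSE : S ⊆ E) (hDE : ∀ δ ∈ S, D δ ⊆ E) (hβ : β ∉ E) :
    initialSegments S D β = ∅ := by
  refine eq_empty_iff_forall_notMem.2 ?_
  rintro C (⟨δ, hδ, hβD, -⟩ | ⟨hβS, -⟩)
  · exact hβ (hDE δ hδ hβD.1)
  · exact hβ (hSE hβS)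

theorem isGuessingSystem_initialSegments (hE : IsClubIn E lam.ord) (hSE : S ⊆ acc E)
    (hD : ∀ δ ∈ S, IsLadder κ δ (D δ)) (hDE : ∀ δ ∈ S, D δ ⊆ E)
    (hcard : ∀ β < lam.ord, #(initialSegments S D β) < Cardinal.lift.{u + 1} lam)
    (hguess : ∀ E', IsClubIn E' lam.ord → ∃ δ ∈ S ∩ E', D δ ⊆ E') :
    IsGuessingSystem lam κ.ord S (initialSegments S D) where
  closed _ _ _ hC := isClosedIn_of_mem_initialSegments hD hC
  card_lt := hcard
  otp_le _ _ _ hC := otp_le_of_mem_initialSegments hD hC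
  exists_club := by
    have hfull : ∀ β C, C ∈ initialSegments S D β → otp C = Ordinal.lift.{u + 1} κ.ord →
        β ∈ S ∧ C = D β := fun β C ↦ eq_of_mem_initialSegments_of_otp_eq hD
    refine ⟨E, hE, fun β _ hβ ↦ initialSegments_eq_empty (fun δ hδ ↦ (hSE hδ).1) hDE hβ,
      fun β _ C ↦ otp_le_of_mem_initialSegments hD, fun β hβ C hC ↦ ?_, fun β hβ ↦ ?_,
      fun β _ C hC h ↦ ?_⟩
    · refine (otp_le_of_mem_initialSegments hD hC).lt_of_ne fun h ↦ hβ.2 ?_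
      have hβS := (hfull β C hC h).1
      exact ⟨hβS, hSE hβS⟩
    · exact ⟨D β, ⟨Or.inr ⟨hβ.1, rfl⟩, (hD β hβ.1).otp_eq⟩, fun C hC ↦ (hfull β C hC.1 hC.2).2⟩
    · obtain ⟨hβS, rfl⟩ := hfull β C hC h
      exact (hD β hβS).isLUB
  coherent _ _ _ hC _ hβ := Iio_inter_mem_initialSegments hC hβ
  guess E' hE' := by
    obtain ⟨δ, hδ, hDδ⟩ := hguess E' hE'
    exact ⟨δ, hδ, D δ, Or.inr ⟨hδ.1, rfl⟩, hDδ, (hD δ hδ.1).otp_eq⟩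

theorem mk_initialSegments_drop_lt (hlam : lam.IsRegular) (hE : IsClubIn E lam.ord)
    (hQ : ∀ β < lam.ord, #(Q β) < Cardinal.lift.{u + 1} lam)
    (hAQ : ∀ δ ∈ S, ∀ α ∈ nacc (A δ), Iio α ∩ A δ ∈ Q α) (hβ : β < lam.ord) :
    #(initialSegments S (fun δ ↦ drop E (A δ)) β) < Cardinal.lift.{u + 1} lam := by
  have hlim := isSuccLimit_ord hlam.aleph0_le
  have hreg : (Cardinal.lift.{u + 1} lam).IsRegular := hlam.lift
  obtain ⟨e, he, hβe⟩ := ((isClubIn_iff hlim).1 hE).2 β hβ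
  have hsub : initialSegments S (fun δ ↦ drop E (A δ)) β ⊆
      (⋃ α ∈ Iic e, drop E '' Q α) ∪ {drop E (A β)} := by
    rintro C (⟨δ, hδ, hβD, rfl⟩ | ⟨-, rfl⟩)
    · obtain ⟨α, hα, hαβ, heq⟩ := exists_eq_drop_of_mem_nacc_drop hβD
      have hαe : α ≤ e := not_lt.1 fun h ↦ hβe.not_ge (hαβ ▸ le_below he h)
      exact Or.inl (mem_biUnion (x := α) hαe ⟨Iio α ∩ A δ, hAQ δ hδ α hα, heq.symm⟩)
    · exact Or.inr rfl
  refine (mk_le_mk_of_subset hsub).trans_lt ((mk_union_le _ _).trans_lt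
    (Cardinal.add_lt_of_lt hreg.aleph0_le ?_ ?_))
  · refine (card_biUnion_lt_iff_forall_of_isRegular hreg ?_).2 fun α hα ↦
      mk_image_le.trans_lt (hQ α (lt_of_le_of_lt hα (hE.1 he)))
    rw [← Order.Iio_succ]
    exact mk_Iio_lt_lift_of_lt_ord (hlim.succ_lt (hE.1 he))
  · rw [mk_singleton]
    exact one_lt_aleph0.trans_le hreg.aleph0_le

end InitialSegments

/-- `Q` approaches `δ` with length `κ`: there is a ladder of length `κ` on `δ` all of whose initial
segments at non-accumulation points `β` belong to `Q β`. -/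
def IsApproachable (Q : Ordinal.{u} → Set (Set Ordinal.{u})) (κ : Cardinal.{u})
    (δ : Ordinal.{u}) : Prop :=
  ∃ A, IsLadder κ δ A ∧ ∀ β ∈ nacc A, Iio β ∩ A ∈ Q β

theorem exists_isGuessingSystem {κ lam : Cardinal.{u}} (hκ : ℵ₀ ≤ κ) (hlam : lam.IsRegular)
    (hlt : succ κ < lam) {Q : Ordinal.{u} → Set (Set Ordinal.{u})}
    (hQ : ∀ β < lam.ord, #(Q β) < Cardinal.lift.{u + 1} lam)
    (hstat : IsStationaryIn {δ | δ < lam.ord ∧ IsApproachable Q κ δ} lam.ord) :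
    ∃ S : Set Ordinal.{u}, IsStationaryIn S lam.ord ∧ (∀ δ ∈ S, δ.cof = κ) ∧
      ∃ P : Ordinal.{u} → Set (Set Ordinal.{u}), IsGuessingSystem lam κ.ord S P := by
  have hlim := isSuccLimit_ord hlam.aleph0_le
  choose! A hA hAQ using fun δ (hδ : δ ∈ {δ | δ < lam.ord ∧ IsApproachable Q κ δ}) ↦ hδ.2
  obtain ⟨E, hE, hguess⟩ := exists_isClubIn_forall_exists_drop_subset hκ
    (hlt.trans_eq hlam.cof_ord.symm) hstat hA
  set S := {δ | δ < lam.ord ∧ IsApproachable Q κ δ} ∩ acc E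
  have hS : IsStationaryIn S lam.ord := isStationaryIn_iff.2 ⟨fun δ hδ ↦ hδ.1.1, fun E' hE' ↦ by
    obtain ⟨δ, hδ, -⟩ := hguess E' hE'
    exact ⟨δ, hδ⟩⟩
  refine ⟨S, hS, fun δ hδ ↦ (hA δ hδ.1).cof_eq, _, isGuessingSystem_initialSegments hE
    inter_subset_right (fun δ hδ ↦ (hA δ hδ.1).drop hδ.2.2) (fun δ hδ ↦ ?_)
    (fun β hβ ↦ mk_initialSegments_drop_lt hlam hE hQ (fun δ hδ ↦ hAQ δ hδ.1) hβ) hguess⟩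
  exact ((isClubIn_iff hlim).1 hE).1.drop_subset fun α hα ↦
    ((hA δ hδ.1).subset_Iio hα).trans hδ.1.1

/-- The sequence through `X` whose `i`-th term is the least element of `X` that lies above all the
earlier terms and that, for every `k < i`, is at least the value of `G k` at the restriction of the
sequence to `[0, k]`. -/
noncomputable def leastSeq (X : Set Ordinal.{u})
    (G : ∀ k : Ordinal.{u}, (Iic k → Ordinal.{u}) → Ordinal.{u}) (i : Ordinal.{u}) : Ordinal.{u} :=
  sInf {x | x ∈ X ∧ ∀ k, (hk : k < i) → leastSeq X G k < x ∧
    G k (fun m ↦ have : m.1 ≤ k := m.2; leastSeq X G m) ≤ x}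
termination_by i
decreasing_by
  · exact hk
  · exact this.trans_lt hk

section LeastSeq

variable {κ lam : Cardinal.{u}} {X E : Set Ordinal.{u}}
  {G : ∀ k : Ordinal.{u}, (Iic k → Ordinal.{u}) → Ordinal.{u}} {i x o : Ordinal.{u}}

theorem leastSeq_le (hx : x ∈ X)
    (h : ∀ k < i, leastSeq X G k < x ∧ G k ((Iic k).domRestrict (leastSeq X G)) ≤ x) :
    leastSeq X G i ≤ x := by
  rw [leastSeq]
  exact csInf_le' ⟨hx, h⟩

theorem leastSeq_spec (hX : ¬ BddAbove X) (i : Ordinal.{u}) : leastSeq X G i ∈ X ∧ ∀ k < i,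
    leastSeq X G k < leastSeq X G i ∧
      G k ((Iic k).domRestrict (leastSeq X G)) ≤ leastSeq X G i := by
  obtain ⟨b, hb⟩ := bddAbove_of_small (s := (fun k ↦ max (leastSeq X G k)
    (G k ((Iic k).domRestrict (leastSeq X G)))) '' Iio i)
  obtain ⟨x, hx, hbx⟩ := not_bddAbove_iff.1 hX b
  have hmax : ∀ k < i, max _ _ < x := fun k hk ↦ (hb (mem_image_of_mem _ hk)).trans_lt hbx
  have hmem := csInf_mem (s := {x | x ∈ X ∧ ∀ k < i, leastSeq X G k < x ∧
    G k ((Iic k).domRestrict (leastSeq X G)) ≤ x})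
    ⟨x, hx, fun k hk ↦ ⟨(max_lt_iff.1 (hmax k hk)).1, (max_lt_iff.1 (hmax k hk)).2.le⟩⟩
  rw [leastSeq]
  exact hmem

theorem isNormal_leastSeq (hX : ¬ BddAbove X) (hcl : IsClosed X) : IsNormal (leastSeq X G) := by
  have hmono : StrictMono (leastSeq X G) := fun k i hk ↦ ((leastSeq_spec hX i).2 k hk).1
  refine isNormal_iff.2 ⟨hmono, fun i hi b hb ↦ ?_⟩
  have hbdd : BddAbove (leastSeq X G '' Iio i) := ⟨b, forall_mem_image.2 hb⟩
  have hne : (leastSeq X G '' Iio i).Nonempty := ⟨_, mem_image_of_mem _ (mem_Iio.2 hi.bot_lt)⟩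
  have hle : ∀ k < i, leastSeq X G k ≤ sSup (leastSeq X G '' Iio i) := fun k hk ↦
    le_csSup hbdd (mem_image_of_mem _ hk)
  refine (leastSeq_le (hcl.closure_subset_iff.2 ?_ (csSup_mem_closure hne hbdd))
    fun k hk ↦ ⟨?_, ?_⟩).trans (csSup_le hne (forall_mem_image.2 hb))
  · exact image_subset_iff.2 fun k _ ↦ (leastSeq_spec hX k).1
  · exact (hmono (lt_add_one k)).trans_le (hle _ (hi.add_one_lt hk))
  · exact ((leastSeq_spec hX (k + 1)).2 k (lt_add_one k)).2.trans (hle _ (hi.add_one_lt hk))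

theorem IsClosedIn.isClosed_union_Ici (hE : IsClosedIn E o) : IsClosed (E ∪ Ici o) := by
  refine isClosed_iff_accPt.2 fun x hx ↦ (lt_or_ge x o).imp_left fun hxo ↦ ?_
  refine hE.mem_of_accPt hxo (accPt_principal_iff.2
    ⟨(accPt_principal_iff.1 hx).1, fun y hy ↦ ?_⟩)
  obtain ⟨a, ha, hya, hax⟩ := (accPt_principal_iff.1 hx).2 y hy
  exact ⟨a, ha.resolve_right (hax.trans hxo).not_ge, hya, hax⟩

theorem exists_isNormal_mem_isClubIn (hlam : lam.IsRegular) (hE : IsClubIn E lam.ord)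
    (hG : ∀ k s, G k s < lam.ord) : ∃ ξ : Ordinal.{u} → Ordinal.{u}, IsNormal ξ ∧
      (∀ i < lam.ord, ξ i ∈ E) ∧ ∀ i, ∀ k < i, G k ((Iic k).domRestrict ξ) ≤ ξ i := by
  obtain ⟨hcl, hunb⟩ := (isClubIn_iff (isSuccLimit_ord hlam.aleph0_le)).1 hE
  have hX : ¬ BddAbove (E ∪ Ici lam.ord) := fun h ↦
    not_bddAbove_Ici lam.ord (h.mono subset_union_right)
  set ξ := leastSeq (E ∪ Ici lam.ord) G
  refine ⟨ξ, isNormal_leastSeq hX hcl.isClosed_union_Ici, fun i hi ↦ ?_,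
    fun i k hk ↦ ((leastSeq_spec hX i).2 k hk).2⟩
  suffices ξ i < lam.ord from (leastSeq_spec hX i).1.resolve_right this.not_ge
  induction i using WellFoundedLT.induction with
  | ind i ih =>
    obtain ⟨β, hβ, hb⟩ := exists_lt_forall_mem_lt (o := lam.ord)
      (X := (fun k ↦ max (ξ k) (G k ((Iic k).domRestrict ξ))) '' Iio i) (by
        rw [hlam.cof_ord]
        exact mk_image_le.trans_lt (mk_Iio_lt_lift_of_lt_ord hi)) (forall_mem_image.2 fun k hk ↦
          max_lt (ih k hk ((mem_Iio.1 hk).trans hi)) (hG _ _))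
    obtain ⟨x, hx, hβx⟩ := hunb β hβ
    refine (leastSeq_le (Or.inl hx) fun k hk ↦ ?_).trans_lt (hE.1 hx)
    have hmax := max_lt_iff.1 ((hb _ (mem_image_of_mem _ hk)).trans hβx)
    exact ⟨hmax.1, hmax.2.le⟩

theorem isStationaryIn_setOf_cof_eq (hlam : lam.IsRegular) (hκ : κ.IsRegular) (hlt : κ < lam) :
    IsStationaryIn {δ | δ < lam.ord ∧ δ.cof = κ} lam.ord := by
  refine isStationaryIn_iff.2 ⟨fun δ hδ ↦ hδ.1, fun E hE ↦ ?_⟩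
  obtain ⟨ξ, hξ, hξE, -⟩ := exists_isNormal_mem_isClubIn (G := fun _ _ ↦ 0) hlam hE
    fun _ _ ↦ hlam.ord_pos
  have hmem := hξE _ (ord_lt_ord.2 hlt)
  refine ⟨ξ κ.ord, ⟨hE.1 hmem, ?_⟩, hmem⟩
  rw [cof_map_of_isNormal hξ (isSuccLimit_ord hκ.aleph0_le), hκ.cof_ord]

end LeastSeq

section Approachability

variable {κ lam : Cardinal.{u}} {C : Set Ordinal.{u}} {o β δ : Ordinal.{u}}

theorem IsLadder.isApproachable_image {Q : Ordinal.{u} → Set (Set Ordinal.{u})}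
    {ξ : Ordinal.{u} → Ordinal.{u}} (hC : IsLadder κ δ C) (hκ : ℵ₀ ≤ κ) (hξ : IsNormal ξ)
    (h : ∀ m ∈ C, ∀ k < m, ξ '' (C ∩ Iic k) ∈ Q (ξ m)) : IsApproachable Q κ (ξ δ) := by
  refine ⟨ξ '' C, hC.image hκ hξ, fun β hβ ↦ ?_⟩
  obtain ⟨m, hm, k, hkm, rfl, heq⟩ := exists_Iio_inter_image_eq_of_mem_nacc hξ hC.pos hβ
  exact heq ▸ h m hm k hkm

theorem mk_image_Iio_prod_lt {α : Type (u + 1)} (F : Ordinal.{u} × Ordinal.{u} × Ordinal.{u} → α)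
    (hlam : ℵ₀ ≤ lam) (hβ : β < lam.ord) (ho : o < lam.ord) :
    #(F '' (Iio β ×ˢ Iio o ×ˢ Iio o)) < Cardinal.lift.{u + 1} lam := by
  have hlam' : ℵ₀ ≤ Cardinal.lift.{u + 1} lam := aleph0_le_lift.2 hlam
  refine mk_image_le.trans_lt ?_
  rw [mk_setProd, mk_setProd]
  have ho' := mk_Iio_lt_lift_of_lt_ord ho
  exact mul_lt_of_lt hlam' (mk_Iio_lt_lift_of_lt_ord hβ) (mul_lt_of_lt hlam' ho' ho')

theorem exists_lt_ord_forall_mem_of_mem {α : Type (u + 1)} {Q : Ordinal.{u} → Set α} {X : Set α}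
    (hlam : lam.IsRegular) (hQ : Monotone Q) (hX : #X < Cardinal.lift.{u + 1} lam) :
    ∃ γ < lam.ord, ∀ B ∈ X, ∀ σ < lam.ord, B ∈ Q σ → B ∈ Q γ := by
  choose! σ hσ hBσ using fun B (hB : B ∈ X ∩ ⋃ σ < lam.ord, Q σ) ↦ mem_iUnion₂.1 hB.2
  obtain ⟨γ, hγ, hσγ⟩ := exists_lt_forall_mem_lt (o := lam.ord)
    (X := σ '' (X ∩ ⋃ σ < lam.ord, Q σ)) (by
      rw [hlam.cof_ord]
      exact mk_image_le.trans_lt ((mk_le_mk_of_subset inter_subset_left).trans_lt hX))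
    (forall_mem_image.2 hσ)
  refine ⟨γ, hγ, fun B hB τ hτ hBτ ↦ ?_⟩
  have hB' : B ∈ X ∩ ⋃ σ < lam.ord, Q σ := ⟨hB, mem_iUnion₂.2 ⟨τ, hτ, hBτ⟩⟩
  exact hQ (hσγ _ (mem_image_of_mem σ hB')).le (hBσ B hB')

end Approachability

section Successor

theorem exists_injOn_mapsTo_Iio_ord (μ : Cardinal.{u}) :
    ∃ g : Ordinal.{u} → Ordinal.{u} → Ordinal.{u}, ∀ β < (succ μ).ord,
      InjOn (g β) (Iio β) ∧ MapsTo (g β) (Iio β) (Iio μ.ord) := by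
  suffices ∀ β < (succ μ).ord, ∃ f : Ordinal.{u} → Ordinal.{u},
      InjOn f (Iio β) ∧ MapsTo f (Iio β) (Iio μ.ord) by
    choose! g hg using this
    exact ⟨g, hg⟩
  intro β hβ
  have hle : #(Iio β) ≤ #(Iio μ.ord) := by
    rw [Cardinal.mk_Iio_ordinal, Cardinal.mk_Iio_ordinal, Cardinal.lift_le, card_ord]
    exact lt_succ_iff.1 (Cardinal.lt_ord.1 hβ)
  obtain ⟨f⟩ := hle
  have happly : ∀ x : Iio β, Function.extend Subtype.val (fun x ↦ (f x).1) 0 x.1 = f x :=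
    Subtype.val_injective.extend_apply _ _
  refine ⟨Function.extend Subtype.val (fun x ↦ (f x).1) 0, fun x hx y hy h ↦ ?_, fun x hx ↦ ?_⟩
  · have hxy := (happly ⟨x, hx⟩).symm.trans (h.trans (happly ⟨y, hy⟩))
    exact Subtype.ext_iff.1 (f.injective (Subtype.ext hxy))
  · exact happly ⟨x, hx⟩ ▸ (f ⟨x, hx⟩).2

/-- The `i`-th level of the filtration of `β` induced by the ranking `g β` of the ordinals below
`β`. -/
def level (g : Ordinal.{u} → Ordinal.{u} → Ordinal.{u}) (β i : Ordinal.{u}) : Set Ordinal.{u} :=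
  {α | α < β ∧ g β α < i}

/-- The successors of the elements of `level g β i`, together with all the ordinals above `β`. The
latter make the set unbounded, so that its closure is the range of a normal function. -/
def levelPoints (g : Ordinal.{u} → Ordinal.{u} → Ordinal.{u}) (β i : Ordinal.{u}) :
    Set Ordinal.{u} :=
  (· + 1) '' level g β i ∪ Ioi β

/-- The sets cut off at `b < β` from the images of the sets `c ε` under the enumerations of the
closures of the sets `levelPoints g b i`, where `i, ε < o`. -/
def levelImages (g : Ordinal.{u} → Ordinal.{u} → Ordinal.{u}) (c : Ordinal.{u} → Set Ordinal.{u})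
    (o β : Ordinal.{u}) : Set (Set Ordinal.{u}) :=
  (fun p : Ordinal.{u} × Ordinal.{u} × Ordinal.{u} ↦
    enumOrd (closure (levelPoints g p.1 p.2.1)) '' c p.2.2 ∩ Iic p.1) ''
      (Iio β ×ˢ Iio o ×ˢ Iio o)

variable {κ μ : Cardinal.{u}} {g : Ordinal.{u} → Ordinal.{u} → Ordinal.{u}}
  {c : Ordinal.{u} → Set Ordinal.{u}} {β δ b i v : Ordinal.{u}}

theorem not_bddAbove_levelPoints : ¬ BddAbove (levelPoints g β i) := fun h ↦
  not_bddAbove_Ioi β (h.mono subset_union_right)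

theorem exists_mem_level_of_mem_levelPoints {x : Ordinal.{u}} (hx : x ∈ levelPoints g β i)
    (hxβ : x ≤ β) : ∃ b ∈ level g β i, x = b + 1 := by
  obtain ⟨b, hb, rfl⟩ := hx.resolve_right (not_lt.2 hxβ)
  exact ⟨b, hb, rfl⟩

theorem mk_level_lt (hg : InjOn (g β) (Iio β)) (hi : i < μ.ord) :
    #(level g β i) < Cardinal.lift.{u + 1} μ := by
  refine lt_of_le_of_lt ?_ (mk_Iio_lt_lift_of_lt_ord hi)
  rw [← mk_image_eq_of_injOn (g β) (level g β i) (hg.mono fun α hα ↦ hα.1)]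
  exact mk_le_mk_of_subset (image_subset_iff.2 fun α hα ↦ hα.2)

theorem exists_gt_forall_mem_level (hμ : μ.IsRegular)
    (hg : ∀ β ≤ δ, InjOn (g β) (Iio β) ∧ MapsTo (g β) (Iio β) (Iio μ.ord)) (hv : v < μ.ord) :
    ∃ w, (v < w ∧ w < μ.ord) ∧ ∀ β ∈ level g δ v, ∀ α < β,
      (g δ α < v → g β α < w) ∧ (g β α < v → g δ α < w) := by
  have hreg : (Cardinal.lift.{u + 1} μ).IsRegular := hμ.lift
  have hlim := isSuccLimit_ord hμ.aleph0_le
  have hδ := mk_level_lt (hg δ le_rfl).1 hv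
  obtain ⟨w, hw, hlt⟩ := exists_lt_forall_mem_lt (o := μ.ord)
    (X := ⋃ β ∈ level g δ v, (g β '' (level g δ v ∩ Iio β) ∪ g δ '' level g β v)) (by
      rw [hμ.cof_ord]
      refine (card_biUnion_lt_iff_forall_of_isRegular hreg hδ).2 fun β hβ ↦
        (mk_union_le _ _).trans_lt (Cardinal.add_lt_of_lt hreg.aleph0_le ?_ ?_)
      · exact (mk_image_le.trans (mk_le_mk_of_subset inter_subset_left)).trans_lt hδ
      · exact mk_image_le.trans_lt (mk_level_lt (hg β hβ.1.le).1 hv)) (by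
      simp only [mem_iUnion₂]
      rintro _ ⟨β, hβ, ⟨α, hα, rfl⟩ | ⟨α, hα, rfl⟩⟩
      · exact (hg β hβ.1.le).2 hα.2
      · exact (hg δ le_rfl).2 (mem_Iio.2 (hα.1.trans hβ.1)))
  refine ⟨max (v + 1) w, ⟨lt_max_of_lt_left (lt_add_one v), max_lt (hlim.add_one_lt hv) hw⟩,
    fun β hβ α hα ↦ ⟨fun h ↦ ?_, fun h ↦ ?_⟩⟩
  · exact lt_max_of_lt_right
      (hlt _ (mem_biUnion hβ (Or.inl ⟨α, ⟨⟨hα.trans hβ.1, h⟩, hα⟩, rfl⟩)))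
  · exact lt_max_of_lt_right (hlt _ (mem_biUnion hβ (Or.inr ⟨α, ⟨hα, h⟩, rfl⟩)))

theorem exists_gt_forall_mem_level_iff (hμ : μ.IsRegular) (hunc : ℵ₀ < μ)
    (hg : ∀ β ≤ δ, InjOn (g β) (Iio β) ∧ MapsTo (g β) (Iio β) (Iio μ.ord)) (hv : v < μ.ord) :
    ∃ i < μ.ord, v < i ∧ ∀ b ∈ level g δ i, ∀ y < b, y ∈ level g δ i ↔ y ∈ level g b i := by
  choose! F hF hFlevel using fun v ↦ exists_gt_forall_mem_level (v := v) hμ hg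
  obtain ⟨i, hi, hvi, h⟩ := exists_lt_forall_lt_apply_lt (hunc.trans_eq hμ.cof_ord.symm) hF hv
  refine ⟨i, hi, hvi, fun b hb y hy ↦ ⟨fun hyi ↦ ⟨hy, ?_⟩, fun hyi ↦ ⟨hy.trans hb.1, ?_⟩⟩⟩
  · obtain ⟨w, hw, hwF, hFi⟩ := h _ (max_lt hb.2 hyi.2)
    exact ((hFlevel w (hwF.trans (hFi.trans hi)) b ⟨hb.1, (le_max_left _ _).trans_lt hw⟩ y hy).1
      ((le_max_right _ _).trans_lt hw)).trans hFi
  · obtain ⟨w, hw, hwF, hFi⟩ := h _ (max_lt hb.2 hyi.2)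
    exact ((hFlevel w (hwF.trans (hFi.trans hi)) b ⟨hb.1, (le_max_left _ _).trans_lt hw⟩ y hy).2
      ((le_max_right _ _).trans_lt hw)).trans hFi

theorem levelPoints_inter_Iic (hb : b < δ)
    (h : ∀ y < b, y ∈ level g δ i ↔ y ∈ level g b i) :
    levelPoints g δ i ∩ Iic b = levelPoints g b i ∩ Iic b := by
  ext x
  refine and_congr_left fun hx ↦ ?_
  have hxb : x ≤ b := hx
  constructor
  · intro hxδ
    obtain ⟨y, hy, rfl⟩ := exists_mem_level_of_mem_levelPoints hxδ (hxb.trans hb.le)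
    exact Or.inl ⟨y, (h y ((lt_add_one y).trans_le hxb)).1 hy, rfl⟩
  · intro hxb'
    obtain ⟨y, hy, rfl⟩ := exists_mem_level_of_mem_levelPoints hxb' hxb
    exact Or.inl ⟨y, (h y hy.1).2 hy, rfl⟩

theorem exists_accPt_levelPoints (hκ : κ.IsRegular) (hμ : μ.IsRegular) (hlt : κ < μ)
    (hg : ∀ β ≤ δ, InjOn (g β) (Iio β) ∧ MapsTo (g β) (Iio β) (Iio μ.ord)) (hδ : δ.cof = κ) :
    ∃ i < μ.ord, AccPt δ (𝓟 (levelPoints g δ i)) ∧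
      ∀ b ∈ level g δ i, levelPoints g δ i ∩ Iic b = levelPoints g b i ∩ Iic b := by
  obtain ⟨A, hA⟩ := exists_isLadder hκ hδ
  have hlim := hA.isSuccLimit hκ.aleph0_le
  obtain ⟨v, hv, hAv⟩ := exists_lt_forall_mem_lt (o := μ.ord) (X := g δ '' A) (by
      rw [hμ.cof_ord]
      refine mk_image_le.trans_lt ?_
      rwa [hA.mk_eq, Cardinal.lift_lt])
    (forall_mem_image.2 fun α hα ↦ (hg δ le_rfl).2 (hA.subset_Iio hα))
  obtain ⟨i, hi, hvi, hcoh⟩ :=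
    exists_gt_forall_mem_level_iff hμ (hκ.aleph0_le.trans_lt hlt) hg hv
  refine ⟨i, hi, accPt_principal_iff.2 ⟨hlim.bot_lt.ne', fun y hy ↦ ?_⟩,
    fun b hb ↦ levelPoints_inter_Iic hb.1 (hcoh b hb)⟩
  obtain ⟨α, hα, hyα⟩ := hA.exists_gt y hy
  have hαδ : α < δ := hA.subset_Iio hα
  exact ⟨α + 1, Or.inl ⟨α, ⟨hαδ, (hAv _ (mem_image_of_mem _ hα)).trans hvi⟩, rfl⟩,
    hyα.trans (lt_add_one α), hlim.add_one_lt hαδ⟩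

theorem exists_lt_ord_enumOrd_closure_levelPoints_eq (hg : InjOn (g δ) (Iio δ)) (hi : i < μ.ord)
    (hδ : AccPt δ (𝓟 (levelPoints g δ i))) :
    ∃ ε < μ.ord, IsSuccLimit ε ∧ enumOrd (closure (levelPoints g δ i)) ε = δ := by
  have hlevel : levelPoints g δ i ∩ Iic δ ⊆ (· + 1) '' level g δ i := fun x hx ↦
    hx.1.resolve_right (not_lt.2 hx.2 : ¬ δ < x)
  have hX : ¬ BddAbove (levelPoints g δ i) := not_bddAbove_levelPoints
  obtain ⟨ε, hε, hεδ⟩ := exists_isSuccLimit_enumOrd_closure_eq hX hδ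
    fun h ↦ by
      obtain ⟨b, -, rfl⟩ := hlevel ⟨h, self_mem_Iic⟩
      exact not_isSuccLimit_add_one b hδ.isSuccLimit
  refine ⟨ε, ?_, hε, hεδ⟩
  rw [Cardinal.lt_ord, ← Cardinal.lift_lt.{u, u + 1}]
  refine (lift_card_le_mk_inter_Iic_enumOrd_closure hX ε).trans_lt ?_
  rw [hεδ]
  exact ((mk_le_mk_of_subset hlevel).trans mk_image_le).trans_lt (mk_level_lt hg hi)

theorem isApproachable_levelImages (hκ : κ.IsRegular) (hμ : μ.IsRegular) (hlt : κ < μ)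
    (hg : ∀ β ≤ δ, InjOn (g β) (Iio β) ∧ MapsTo (g β) (Iio β) (Iio μ.ord))
    (hc : ∀ ε, ε.cof = κ → IsLadder κ ε (c ε)) (hδ : δ.cof = κ) :
    IsApproachable (levelImages g c μ.ord) κ δ := by
  obtain ⟨i, hi, hacc, hcoh⟩ := exists_accPt_levelPoints hκ hμ hlt hg hδ
  obtain ⟨ε, hεμ, hε, hεδ⟩ :=
    exists_lt_ord_enumOrd_closure_levelPoints_eq (hg δ le_rfl).1 hi hacc
  have hX : ¬ BddAbove (levelPoints g δ i) := not_bddAbove_levelPoints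
  have hf := isNormal_enumOrd_closure hX
  set f := enumOrd (closure (levelPoints g δ i))
  have hladder : IsLadder κ ε (c ε) := hc ε (by rw [← cof_map_of_isNormal hf hε, hεδ, hδ])
  rw [← hεδ]
  refine hladder.isApproachable_image hκ.aleph0_le hf fun m hm k hkm ↦ ?_
  have hfm : f (k + 1) ≤ f m := hf.monotone (add_one_le_of_lt hkm)
  obtain ⟨b, hb, hkb⟩ := exists_mem_level_of_mem_levelPoints (enumOrd_closure_add_one_mem hX k)
    (hfm.trans ((hf.strictMono (hladder.subset_Iio hm)).trans_eq hεδ).le)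
  have hbm : b < f m := (lt_add_one b).trans_le (hkb ▸ hfm)
  have hpre : f ⁻¹' Iic b = Iic k := by
    ext x
    rw [mem_preimage, mem_Iic, mem_Iic, ← lt_add_one_iff, ← hkb, hf.strictMono.lt_iff_lt,
      lt_add_one_iff]
  refine ⟨(b, i, ε), ⟨hbm, hi, hεμ⟩, ?_⟩
  calc enumOrd (closure (levelPoints g b i)) '' c ε ∩ Iic b
      = f '' c ε ∩ Iic b := image_enumOrd_closure_inter_Iic_congr not_bddAbove_levelPoints hX
          (hcoh b hb).symm _
    _ = f '' (c ε ∩ f ⁻¹' Iic b) := (image_inter_preimage f _ _).symm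
    _ = f '' (c ε ∩ Iic k) := by rw [hpre]

theorem exists_isStationaryIn_setOf_isApproachable_succ (hκ : κ.IsRegular) (hμ : μ.IsRegular)
    (hlt : κ < μ) : ∃ Q : Ordinal.{u} → Set (Set Ordinal.{u}),
      (∀ β < (succ μ).ord, #(Q β) < Cardinal.lift.{u + 1} (succ μ)) ∧
      IsStationaryIn {δ | δ < (succ μ).ord ∧ IsApproachable Q κ δ} (succ μ).ord := by
  have hreg := isRegular_succ hμ.aleph0_le
  obtain ⟨g, hg⟩ := exists_injOn_mapsTo_Iio_ord μ
  choose! c hc using fun ε ↦ exists_isLadder (δ := ε) hκ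
  refine ⟨levelImages g c μ.ord, fun β hβ ↦ mk_image_Iio_prod_lt _ hreg.aleph0_le hβ
    (ord_lt_ord.2 (lt_succ μ)), isStationaryIn_iff.2 ⟨fun δ hδ ↦ hδ.1, fun E hE ↦ ?_⟩⟩
  obtain ⟨δ, ⟨hδ, hcof⟩, hδE⟩ := (isStationaryIn_iff.1
    (isStationaryIn_setOf_cof_eq hreg hκ (hlt.trans (lt_succ μ)))).2 E hE
  exact ⟨δ, ⟨hδ, isApproachable_levelImages hκ hμ hlt (fun β hβ ↦ hg β (hβ.trans_lt hδ)) hc hcof⟩,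
    hδE⟩

end Successor

section Between

variable {κ θ lam : Cardinal.{u}}

theorem exists_guessing_ladders (hκ : κ.IsRegular) (hθ : θ.IsRegular) (hlt : succ κ < θ) :
    ∃ C : Ordinal.{u} → Set Ordinal.{u}, ∀ E, IsClubIn E θ.ord →
      ∃ j < θ.ord, IsLadder κ j (C j) ∧ C j ⊆ E := by
  choose! A hA using fun δ ↦ exists_isLadder (δ := δ) hκ
  obtain ⟨E, -, hguess⟩ := exists_isClubIn_forall_exists_drop_subset hκ.aleph0_le
    (hlt.trans_eq hθ.cof_ord.symm)
    (isStationaryIn_setOf_cof_eq hθ hκ ((lt_succ κ).trans hlt)) fun δ hδ ↦ hA δ hδ.2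
  refine ⟨fun δ ↦ drop E (A δ), fun E' hE' ↦ ?_⟩
  obtain ⟨δ, ⟨⟨⟨hδ, hcof⟩, hacc⟩, -⟩, hsub⟩ := hguess E' hE'
  exact ⟨δ, hδ, (hA δ hcof).drop hacc.2, hsub⟩

/-- The images under `f δ`, for `δ < σ`, of the initial segments `C j ∩ [0, k]` with `j, k < o`. -/
def segmentImages (f : Ordinal.{u} → Ordinal.{u} → Ordinal.{u}) (C : Ordinal.{u} → Set Ordinal.{u})
    (o σ : Ordinal.{u}) : Set (Set Ordinal.{u}) :=
  (fun p : Ordinal.{u} × Ordinal.{u} × Ordinal.{u} ↦ f p.1 '' (C p.2.1 ∩ Iic p.2.2)) ''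
    (Iio σ ×ˢ Iio o ×ˢ Iio o)

theorem monotone_segmentImages (f : Ordinal.{u} → Ordinal.{u} → Ordinal.{u})
    (C : Ordinal.{u} → Set Ordinal.{u}) (o : Ordinal.{u}) : Monotone (segmentImages f C o) :=
  fun _ _ h ↦ image_mono (prod_mono_left (Iio_subset_Iio h))

theorem exists_isNormal_forall_image_mem {Q : Ordinal.{u} → Set (Set Ordinal.{u})}
    {E : Set Ordinal.{u}} (C : Ordinal.{u} → Set Ordinal.{u}) (hlam : lam.IsRegular)
    (hQ : Monotone Q) (hE : IsClubIn E lam.ord) (hlt : θ < lam) :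
    ∃ ξ : Ordinal.{u} → Ordinal.{u}, IsNormal ξ ∧ (∀ i < lam.ord, ξ i ∈ E) ∧
      ∀ j < θ.ord, ∀ i, ∀ k < i, ∀ σ < lam.ord,
        ξ '' (C j ∩ Iic k) ∈ Q σ → ξ '' (C j ∩ Iic k) ∈ Q (ξ i) := by
  choose G hG hGQ using fun k (s : Iic k → Ordinal.{u}) ↦ exists_lt_ord_forall_mem_of_mem
    (X := (fun j ↦ s '' (Subtype.val ⁻¹' C j)) '' Iio θ.ord) hlam hQ
    (mk_image_le.trans_lt (mk_Iio_lt_lift_of_lt_ord (ord_lt_ord.2 hlt)))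
  obtain ⟨ξ, hξ, hξE, hξG⟩ := exists_isNormal_mem_isClubIn hlam hE hG
  refine ⟨ξ, hξ, hξE, fun j hj i k hk σ hσ h ↦ hQ (hξG i k hk) ?_⟩
  refine hGQ k _ _ ⟨j, hj, ?_⟩ σ hσ h
  simp only [domRestrict_eq, image_comp, Subtype.image_preimage_coe, inter_comm]

theorem exists_isStationaryIn_setOf_isApproachable_of_succ_lt_of_lt (hκ : κ.IsRegular)
    (hθ : θ.IsRegular) (hlam : lam.IsRegular) (hlt : succ κ < θ) (hlt' : θ < lam) :
    ∃ Q : Ordinal.{u} → Set (Set Ordinal.{u}),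
      (∀ β < lam.ord, #(Q β) < Cardinal.lift.{u + 1} lam) ∧
      IsStationaryIn {δ | δ < lam.ord ∧ IsApproachable Q κ δ} lam.ord := by
  have hθlim := isSuccLimit_ord hθ.aleph0_le
  have hθlam := ord_lt_ord.2 hlt'
  have hunc : ℵ₀ < θ.ord.cof := by
    rw [hθ.cof_ord]
    exact hκ.aleph0_le.trans_lt ((lt_succ κ).trans hlt)
  obtain ⟨C, hC⟩ := exists_guessing_ladders hκ hθ hlt
  choose! f hf hfδ using fun δ ↦ exists_isNormal_apply_cof_ord (δ := δ)
  set Q := segmentImages f C θ.ord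
  have hQ : Monotone Q := monotone_segmentImages f C θ.ord
  refine ⟨Q, fun β hβ ↦ mk_image_Iio_prod_lt _ hlam.aleph0_le hβ hθlam,
    isStationaryIn_iff.2 ⟨fun δ hδ ↦ hδ.1, fun E hE ↦ ?_⟩⟩
  obtain ⟨ξ, hξ, hξE, hξQ⟩ := exists_isNormal_forall_image_mem C hlam hQ hE hlt'
  set δ := ξ θ.ord
  have hδ : IsSuccLimit δ := hξ.map_isSuccLimit hθlim
  have hcof : δ.cof = θ := (cof_map_of_isNormal hξ hθlim).trans hθ.cof_ord
  have hfξ : f δ θ.ord = δ := hcof ▸ hfδ δ hδ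
  obtain ⟨j, hj, hladder, hCj⟩ := hC _ (isClubIn_setOf_eq_of_isNormal (hf δ hδ) hξ hunc hfξ)
  have hξj := hξE j (hj.trans hθlam)
  refine ⟨ξ j, ⟨hE.1 hξj, hladder.isApproachable_image hκ.aleph0_le hξ fun m hm k hk ↦ ?_⟩, hξj⟩
  have hkθ : k < θ.ord := hk.trans ((hladder.subset_Iio hm).trans hj)
  have hδlam := (isSuccLimit_ord hlam.aleph0_le).add_one_lt (hE.1 (hξE _ hθlam))
  have himage : f δ '' (C j ∩ Iic k) = ξ '' (C j ∩ Iic k) := image_congr fun x hx ↦ (hCj hx.1).2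
  exact hξQ j hj m k hk (δ + 1) hδlam ⟨(δ, j, k), ⟨lt_add_one δ, hj, hkθ⟩, himage⟩

end Between

end GuessingClubs

theorem mainTheorem4_general (lam kap : Cardinal.{u}) (hlam : lam.IsRegular) (hkap : kap.IsRegular)
    (hlt : Order.succ kap < lam) :
    ∃ S : Set Ordinal.{u}, GuessingClubs.IsStationaryIn S lam.ord ∧
      (∀ δ ∈ S, δ.cof = kap) ∧
      ∃ P : Ordinal.{u} → Set (Set Ordinal.{u}),
        GuessingClubs.IsGuessingSystem lam kap.ord S P := by
  have hsucc : (Order.succ kap).IsRegular := isRegular_succ hkap.aleph0_le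
  obtain ⟨Q, hQ, hstat⟩ : ∃ Q : Ordinal.{u} → Set (Set Ordinal.{u}),
      (∀ β < lam.ord, #(Q β) < Cardinal.lift.{u + 1} lam) ∧ GuessingClubs.IsStationaryIn
        {δ | δ < lam.ord ∧ GuessingClubs.IsApproachable Q kap δ} lam.ord := by
    rcases (Order.succ_le_of_lt hlt).eq_or_lt with rfl | hlt'
    · exact GuessingClubs.exists_isStationaryIn_setOf_isApproachable_succ hkap hsucc
        (Order.lt_succ kap)
    · exact GuessingClubs.exists_isStationaryIn_setOf_isApproachable_of_succ_lt_of_lt hkap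
        (isRegular_succ hsucc.aleph0_le) hlam (Order.lt_succ _) hlt'
  exact GuessingClubs.exists_isGuessingSystem hkap.aleph0_le hlam hlt hQ hstat

theorem mainTheorem4 (lam kap : Cardinal.{u}) (hlam : lam.IsRegular) (hkap : kap.IsRegular)
    (hunc : ℵ₀ < kap) (hlt : Order.succ kap < lam) :
    ∃ S : Set Ordinal.{u}, GuessingClubs.IsStationaryIn S lam.ord ∧
      (∀ δ ∈ S, δ.cof = kap) ∧
      ∃ P : Ordinal.{u} → Set (Set Ordinal.{u}),
        GuessingClubs.IsGuessingSystem lam kap.ord S P :=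
  mainTheorem4_general lam kap hlam hkap hlt
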